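/- Let $d\in\{2,3\}$ and let $\sigma>0$. Below, $\Omega\subset\mathbb R^d$ is a bounded simply connected open set with Lipschitz boundary $\Gamma$ and outer unit normal $\mathbf n$ that can be completely meshed, and $\mathcal T_h$ is a conforming triangulation of $\overline\Omega$ into finitely many closed non-degenerate simplices with $h_\kappa\le\sigma\rho_\kappa$ for all $\kappa\in\mathcal T_h$, where $h_\kappa$ is the diameter of $\kappa$ and $\rho_\kappa$ that of its inscribed ball. Let $X=L^3(\Omega)^d$, $M=W^{1,3/2}(\Omega)\cap L^2_0(\Omega)$, $Y=H^1_0(\Omega)$. Data: $\mu,\rho,\beta,\alpha,r_0,\gamma>0$; $K$ is a measurable tensor field such that, for some $0<K_m\le K_M$, $K_m|\xi|^2\le K^{-1}\xi\cdot\xi$ and $|K^{-1}\xi|\le K_M|\xi|$ for all $\xi\in\mathbb R^d$, a.e. in $\Omega$; $\mathbf f(\mathbf x,C)=\mathbf f_0(\mathbf x)+\mathbf f_1(C)$ with $\mathbf f_0\in L^{3/2}(\Omega)^d$ and $\mathbf f_1:\mathbb R\to\mathbb R^d$ Lipschitz, $\mathbf f_1(0)=0$; $g\in L^2(\Omega)$.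 Let $(\mathbf u,p,C)\in X\times M\times Y$ solve, for all $(\mathbf v,q,S)\in X\times M\times Y$, $$\tfrac{\mu}{\rho}\int_\Omega K^{-1}\mathbf u\cdot\mathbf v+\tfrac{\beta}{\rho}\int_\Omega|\mathbf u|\mathbf u\cdot\mathbf v+\int_\Omega\nabla p\cdot\mathbf v=\int_\Omega\mathbf f(\cdot,C)\cdot\mathbf v,\qquad \int_\Omega\nabla q\cdot\mathbf u=0,$$ $$\alpha\int_\Omega\nabla C\cdot\nabla S+\int_\Omega(\mathbf u\cdot\nabla C)S+r_0\int_\Omega CS=\int_\Omega gS.$$ Let $X_h$ be the space of continuous vector fields on $\overline\Omega$ whose restriction to each $\kappa\in\mathcal T_h$ lies in $(\mathbb P_1(\kappa)\oplus\mathrm{Vect}\{b_\kappa\})^d$, where $b_\kappa$ is the product of the $d+1$ barycentric coordinates of $\kappa$; let $M_h$, resp. $Y_h$, be the space of continuous functions on $\overline\Omega$ that are affine on each $\kappa$ and have mean zero, resp. lie in $H^1_0(\Omega)$. Let $\mathbf u_h^0\in X_h$, $C_h^0\in Y_h$ and, for $i\ge0$, let $(\mathbf u_h^{i+1},p_h^{i+1},C_h^{i+1})\in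 X_h\times M_h\times Y_h$ satisfy, for all $(\mathbf v_h,q_h,S_h)\in X_h\times M_h\times Y_h$, $$\gamma\int_\Omega(\mathbf u_h^{i+1}-\mathbf u_h^i)\cdot\mathbf v_h+\tfrac{\mu}{\rho}\int_\Omega K^{-1}\mathbf u_h^{i+1}\cdot\mathbf v_h+\tfrac{\beta}{\rho}\int_\Omega|\mathbf u_h^i|\mathbf u_h^{i+1}\cdot\mathbf v_h+\int_\Omega\nabla p_h^{i+1}\cdot\mathbf v_h=\int_\Omega\mathbf f(\cdot,C_h^i)\cdot\mathbf v_h,$$ $$\int_\Omega\nabla q_h\cdot\mathbf u_h^{i+1}=0,$$ $$\alpha\int_\Omega\nabla C_h^{i+1}\cdot\nabla S_h+\int_\Omega(\mathbf u_h^{i+1}\cdot\nabla C_h^{i+1})S_h+\tfrac12\int_\Omega\operatorname{div}(\mathbf u_h^{i+1})C_h^{i+1}S_h+r_0\int_\Omega C_h^{i+1}S_h=\int_\Omega gS_h.$$ For a face $e$ (edge if $d=2$) of the mesh put $\phi_{h,1}^e=\mathbf u_h^{i+1}\cdot\mathbf n$ if $e\subset\Gamma$, and $\phi_{h,1}^e=\frac12[\mathbf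 u_h^{i+1}\cdot\mathbf n]_e$ otherwise, where $[\cdot]_e$ is the jump through $e$. Let $h_e$ be the diameter of $e$, let $w_\kappa$ be the union of the elements of $\mathcal T_h$ meeting $\kappa$, and set $$\eta^{(L_1)}_{\kappa,i}=\|\mathbf u_h^{i+1}-\mathbf u_h^i\|_{L^2(\kappa)},\qquad \eta^{(D_3)}_{\kappa,i}=h_\kappa\|\operatorname{div}\mathbf u_h^{i+1}\|_{L^3(\kappa)}+\sum_{e\subset\partial\kappa}h_e^{1/3}\|\phi_{h,1}^e\|_{L^3(e)}.$$ Let $r_h$ be any operator mapping each $q\in M$ to a continuous function on $\overline\Omega$ that is affine on every element (for instance a Clément-type interpolation operator), and let $\mathbf v_r\in L^3(\Omega)^d$ be any lifting of the pressure residual, i.e. $$\int_\Omega\nabla q\cdot\mathbf v_r=\sum_{\kappa\in\mathcal T_h}\Big(\int_\kappa(q-r_hq)\operatorname{div}\mathbf u_h^{i+1}-\sum_{e\subset\partial\kappa}\int_e\phi_{h,1}^e\,(q-r_hq)\,ds\Big)\qquad\text{for all }q\in M,$$ where $q$ is understood on $e$ in the sense of traces. Theorem. There is a constant $c>0$ depending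 only on $d$ and $\sigma$ (in particular independent of $h$) such that, in every such situation, for all $\kappa\in\mathcal T_h$ and all $i\ge0$, $$\eta^{(L_1)}_{\kappa,i}\le\|\mathbf u-\mathbf u_h^i\|_{L^2(\kappa)}+\|\mathbf u-\mathbf u_h^{i+1}\|_{L^2(\kappa)}\qquad\text{and}\qquad \eta^{(D_3)}_{\kappa,i}\le c\,\|\mathbf v_r\|_{L^3(w_\kappa)}.$$ -/

import Mathlib

open MeasureTheory Set Filter Topology
open scoped NNReal ENNReal ContDiff

namespace DarcyForchheimer

noncomputable section

/-- Euclidean space `ℝ^d`. -/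
abbrev E (d : ℕ) : Type := EuclideanSpace ℝ (Fin d)

/-! ### Domains and function spaces -/

/-- The boundary of `Ω` is locally the graph of a Lipschitz function (in the direction `ν`), with
`Ω` lying on one side of it. -/
def HasLipschitzBoundary {d : ℕ} (Ω : Set (E d)) : Prop :=
  ∀ x ∈ frontier Ω, ∃ U ∈ 𝓝 x, ∃ ν : E d, ‖ν‖ = 1 ∧ ∃ (L : ℝ≥0) (g : E d → ℝ),
    LipschitzWith L g ∧ (∀ (y : E d) (t : ℝ), g (y + t • ν) = g y) ∧
      ∀ y ∈ U, (y ∈ Ω ↔ inner ℝ y ν < g y)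

/-- Lebesgue measure on `Ω`. -/
abbrev vol {d : ℕ} (Ω : Set (E d)) : Measure (E d) := volume.restrict Ω

/-- `φ` is a test function on `Ω`, i.e. `φ ∈ C_c^∞(Ω)`. -/
def IsTest {d : ℕ} (Ω : Set (E d)) (φ : E d → ℝ) : Prop :=
  ContDiff ℝ ∞ φ ∧ HasCompactSupport φ ∧ tsupport φ ⊆ Ω

/-- `G` is the weak gradient of `q` in `Ω` (for locally integrable `q` and `G`). -/
def HasWeakGradient {d : ℕ} (Ω : Set (E d)) (q : E d → ℝ) (G : E d → E d) : Prop :=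
  ∀ φ, IsTest Ω φ → ∫ x in Ω, q x • gradient φ x = - ∫ x in Ω, φ x • G x

/-- The velocity space `X = L^3(Ω)^d`. -/
def MemX {d : ℕ} (Ω : Set (E d)) (v : E d → E d) : Prop := MemLp v 3 (vol Ω)

/-- The pressure space: `q ∈ M = W^{1,3/2}(Ω) ∩ L^2_0(Ω)`, with weak gradient `G`. -/
structure MemM {d : ℕ} (Ω : Set (E d)) (q : E d → ℝ) (G : E d → E d) : Prop where
  memLp : MemLp q (3 / 2) (vol Ω)
  grad_memLp : MemLp G (3 / 2) (vol Ω)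
  weak : HasWeakGradient Ω q G
  memLp_two : MemLp q 2 (vol Ω)
  mean_zero : ∫ x in Ω, q x = 0

/-- The concentration space: `S ∈ Y = H^1_0(Ω)`, the closure of `C_c^∞(Ω)` in `H^1(Ω)`, with weak
gradient `G`. -/
structure MemY {d : ℕ} (Ω : Set (E d)) (S : E d → ℝ) (G : E d → E d) : Prop where
  memLp : MemLp S 2 (vol Ω)
  grad_memLp : MemLp G 2 (vol Ω)
  approx : ∃ φ : ℕ → E d → ℝ, (∀ n, IsTest Ω (φ n)) ∧
    Tendsto (fun n => eLpNorm (φ n - S) 2 (vol Ω)) atTop (𝓝 0) ∧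
    Tendsto (fun n => eLpNorm (gradient (φ n) - G) 2 (vol Ω)) atTop (𝓝 0)

/-! ### The continuous problem -/

/-- Physical parameters and sources of the coupled problem. -/
structure Coeffs (d : ℕ) where
  μ : ℝ
  ρ : ℝ
  β : ℝ
  α : ℝ
  r₀ : ℝ
  /-- permeability tensor -/
  K : E d → Matrix (Fin d) (Fin d) ℝ
  f₀ : E d → E d
  f₁ : ℝ → E d
  g : E d → ℝ

namespace Coeffs

variable {d : ℕ} (D : Coeffs d)

/-- `K(x)⁻¹ ξ`. -/
def Kinv (x ξ : E d) : E d := WithLp.toLp 2 ((D.K x)⁻¹.mulVec ξ.ofLp)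

/-- `f(x, C) = f₀(x) + f₁(C)`. -/
def f (x : E d) (C : ℝ) : E d := D.f₀ x + D.f₁ C

/-- The standing assumptions on the parameters, the permeability tensor and the sources. -/
structure Admissible (Ω : Set (E d)) : Prop where
  μ_pos : 0 < D.μ
  ρ_pos : 0 < D.ρ
  β_pos : 0 < D.β
  α_pos : 0 < D.α
  r₀_pos : 0 < D.r₀
  K_meas : ∀ a b, AEStronglyMeasurable (fun x => D.K x a b) (vol Ω)
  K_bounds : ∃ Km KM : ℝ, 0 < Km ∧ ∀ᵐ x ∂(vol Ω), ∀ ξ : E d,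
    Km * ‖ξ‖ ^ 2 ≤ inner ℝ (D.Kinv x ξ) ξ ∧ ‖D.Kinv x ξ‖ ≤ KM * ‖ξ‖
  f₀_memLp : MemLp D.f₀ (3 / 2) (vol Ω)
  f₁_lipschitz : ∃ L : ℝ≥0, LipschitzWith L D.f₁
  f₁_zero : D.f₁ 0 = 0
  g_memLp : MemLp D.g 2 (vol Ω)

/-- `(u, p, C) ∈ X × M × Y` solves the variational problem `(V_a)`. -/
def IsWeakSolution (Ω : Set (E d)) (u : E d → E d) (p C : E d → ℝ) : Prop :=
  ∃ Gp GC : E d → E d, MemX Ω u ∧ MemM Ω p Gp ∧ MemY Ω C GC ∧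
    (∀ v, MemX Ω v →
      D.μ / D.ρ * (∫ x in Ω, inner ℝ (D.Kinv x (u x)) (v x))
        + D.β / D.ρ * (∫ x in Ω, ‖u x‖ * inner ℝ (u x) (v x))
        + (∫ x in Ω, inner ℝ (Gp x) (v x))
        = ∫ x in Ω, inner ℝ (D.f x (C x)) (v x)) ∧
    (∀ q Gq, MemM Ω q Gq → ∫ x in Ω, inner ℝ (Gq x) (u x) = 0) ∧
    (∀ S GS, MemY Ω S GS →
      D.α * (∫ x in Ω, inner ℝ (GC x) (GS x))
        + (∫ x in Ω, inner ℝ (u x) (GC x) * S x)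
        + D.r₀ * (∫ x in Ω, C x * S x)
        = ∫ x in Ω, D.g x * S x)

end Coeffs

/-! ### Triangulations and discrete spaces -/

/-- The closed (non-degenerate) simplex with vertices `κ 0, …, κ d`. Its barycentric coordinates
are `κ.coord 0, …, κ.coord d`. -/
def cell {d : ℕ} (κ : AffineBasis (Fin (d + 1)) ℝ (E d)) : Set (E d) := convexHull ℝ (range κ)

/-- The face (edge if `d = 2`) of the simplex `κ` opposite to its vertex `j`. -/
def face {d : ℕ} (κ : AffineBasis (Fin (d + 1)) ℝ (E d)) (j : Fin (d + 1)) : Set (E d) :=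
  convexHull ℝ (κ '' {j}ᶜ)

/-- The unit normal to the face opposite to the vertex `j`, pointing out of `κ`. -/
def normal {d : ℕ} (κ : AffineBasis (Fin (d + 1)) ℝ (E d)) (j : Fin (d + 1)) : E d :=
  -(‖gradient (κ.coord j) (κ j)‖⁻¹ • gradient (κ.coord j) (κ j))

/-- Surface measure (arc length if `d = 2`) on a face. -/
def surf {d : ℕ} (e : Set (E d)) : Measure (E d) :=
  (Measure.euclideanHausdorffMeasure (d - 1)).restrict e

/-- The bubble function `b_κ = λ_1 ⋯ λ_{d+1}`. -/
def bubble {d : ℕ} (κ : AffineBasis (Fin (d + 1)) ℝ (E d)) (x : E d) : ℝ := ∏ j, κ.coord j x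

/-- The diameter of the largest ball contained in `κ`. -/
def inDiam {d : ℕ} (κ : AffineBasis (Fin (d + 1)) ℝ (E d)) : ℝ :=
  sSup {δ : ℝ | 0 ≤ δ ∧ ∃ x, Metric.closedBall x (δ / 2) ⊆ cell κ}

/-- A conforming triangulation of `Ω` into finitely many non-degenerate closed simplices: they
cover the closure of `Ω`, and two distinct ones meet in the (possibly empty) simplex spanned by
their common vertices. -/
structure Triangulation {d : ℕ} (Ω : Set (E d)) where
  N : ℕ
  elem : Fin N → AffineBasis (Fin (d + 1)) ℝ (E d)
  distinct : ∀ i i', range (elem i) = range (elem i') → i = i'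
  cover : ⋃ i, cell (elem i) = closure Ω
  conforming : ∀ i i', i ≠ i' →
    cell (elem i) ∩ cell (elem i') = convexHull ℝ (range (elem i) ∩ range (elem i'))

/-- `h_κ ≤ σ ρ_κ` for every element. -/
def Triangulation.Regular {d : ℕ} {Ω : Set (E d)} (T : Triangulation Ω) (σ : ℝ) : Prop :=
  ∀ i, Metric.diam (cell (T.elem i)) / inDiam (T.elem i) ≤ σ

/-- Divergence of a vector field. -/
def div {d : ℕ} (v : E d → E d) (x : E d) : ℝ :=
  ∑ a, (fderiv ℝ v x (EuclideanSpace.single a 1)) a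

namespace Triangulation

variable {d : ℕ} {Ω : Set (E d)} (T : Triangulation Ω)

/-- Continuous functions on the closure of `Ω` that are affine on every element. -/
def MemP1 (q : E d → ℝ) : Prop :=
  ContinuousOn q (closure Ω) ∧ ∀ i, ∃ A : E d →ᵃ[ℝ] ℝ, EqOn q A (cell (T.elem i))

/-- The discrete velocity space `X_h`: continuous, and in `(P_1 ⊕ Vect{b_κ})^d` on every `κ`. -/
def MemXh (v : E d → E d) : Prop :=
  ContinuousOn v (closure Ω) ∧ ∀ i, ∃ (A : E d →ᵃ[ℝ] E d) (c : E d),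
    EqOn v (fun x => A x + bubble (T.elem i) x • c) (cell (T.elem i))

/-- The discrete pressure space `M_h`. -/
def MemMh (q : E d → ℝ) : Prop := T.MemP1 q ∧ ∫ x in Ω, q x = 0

/-- The discrete concentration space `Y_h`. -/
def MemYh (S : E d → ℝ) : Prop := T.MemP1 S ∧ ∃ G, MemY Ω S G

/-- One step of the iterative scheme `(V_ahi)`: from `(u, C) = (u_h^i, C_h^i)` to
`(u', p', C') = (u_h^{i+1}, p_h^{i+1}, C_h^{i+1}) ∈ X_h × M_h × Y_h`. Gradients and divergences of
discrete functions are the classical ones, which exist inside every element. -/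
def IsStep (D : Coeffs d) (γ : ℝ) (u : E d → E d) (C : E d → ℝ)
    (u' : E d → E d) (p' C' : E d → ℝ) : Prop :=
  T.MemXh u' ∧ T.MemMh p' ∧ T.MemYh C' ∧
    (∀ v, T.MemXh v →
      γ * (∫ x in Ω, inner ℝ (u' x - u x) (v x))
        + D.μ / D.ρ * (∫ x in Ω, inner ℝ (D.Kinv x (u' x)) (v x))
        + D.β / D.ρ * (∫ x in Ω, ‖u x‖ * inner ℝ (u' x) (v x))
        + (∫ x in Ω, inner ℝ (gradient p' x) (v x))
        = ∫ x in Ω, inner ℝ (D.f x (C x)) (v x)) ∧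
    (∀ q, T.MemMh q → ∫ x in Ω, inner ℝ (gradient q x) (u' x) = 0) ∧
    (∀ S, T.MemYh S →
      D.α * (∫ x in Ω, inner ℝ (gradient C' x) (gradient S x))
        + (∫ x in Ω, inner ℝ (u' x) (gradient C' x) * S x)
        + 1 / 2 * (∫ x in Ω, div u' x * C' x * S x)
        + D.r₀ * (∫ x in Ω, C' x * S x)
        = ∫ x in Ω, D.g x * S x)

/-- `(u i, p i, C i)` are the iterates `(u_h^i, p_h^i, C_h^i)` produced by the scheme from the
initial guesses `u 0 ∈ X_h`, `C 0 ∈ Y_h` (the value of `p 0` plays no role). -/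
def IsIteration (D : Coeffs d) (γ : ℝ) (u : ℕ → E d → E d) (p C : ℕ → E d → ℝ) : Prop :=
  T.MemXh (u 0) ∧ T.MemYh (C 0) ∧
    ∀ i, T.IsStep D γ (u i) (C i) (u (i + 1)) (p (i + 1)) (C (i + 1))

/-! ### Indicators -/

open Classical in
/-- The jump `[u · n]_e` through the face `e` of element `k` opposite to vertex `j`: the sum, over
the elements having `e` as a face, of the one-sided limits of `u` from inside these elements,
multiplied by the respective outward normals. -/
def jump (u : E d → E d) (k : Fin T.N) (j : Fin (d + 1)) (x : E d) : ℝ :=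
  ∑ k', ∑ j', if face (T.elem k') j' = face (T.elem k) j then
    inner ℝ (extendFrom (interior (cell (T.elem k'))) u x) (normal (T.elem k') j') else 0

open Classical in
/-- The function `φ_{h,1}^e` on the face `e` of element `k` opposite to vertex `j`. -/
def phi (u : E d → E d) (k : Fin T.N) (j : Fin (d + 1)) (x : E d) : ℝ :=
  if face (T.elem k) j ⊆ frontier Ω then inner ℝ (u x) (normal (T.elem k) j)
  else 1 / 2 * T.jump u k j x

/-- `w_κ`, the union of the elements that intersect the element `k`. -/
def patch (k : Fin T.N) : Set (E d) :=
  ⋃ k' ∈ {k' | (cell (T.elem k) ∩ cell (T.elem k')).Nonempty}, cell (T.elem k')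

/-- The linearization indicator `η^{(L1)}` of two consecutive velocities `u = u_h^i`,
`u' = u_h^{i+1}`. -/
def etaL1 (u u' : E d → E d) (k : Fin T.N) : ℝ := lpNorm (u' - u) 2 (vol (cell (T.elem k)))

/-- The discretization indicator `η^{(D3)}` of the velocity `u' = u_h^{i+1}`. -/
def etaD3 (u' : E d → E d) (k : Fin T.N) : ℝ :=
  Metric.diam (cell (T.elem k)) * lpNorm (div u') 3 (vol (cell (T.elem k)))
    + ∑ j, Metric.diam (face (T.elem k) j) ^ (1 / 3 : ℝ)
        * lpNorm (T.phi u' k j) 3 (surf (face (T.elem k) j))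

/-- `t` is the trace on the face `j` of the element `κ` of a function `q ∈ W^{1,3/2}(κ)` with weak
gradient `G`: the limit in `L^{3/2}` of the restrictions of smooth functions that converge to `q`
in `W^{1,3/2}(κ)`. -/
def IsTrace (κ : AffineBasis (Fin (d + 1)) ℝ (E d)) (j : Fin (d + 1))
    (q : E d → ℝ) (G : E d → E d) (t : E d → ℝ) : Prop :=
  MemLp t (3 / 2) (surf (face κ j)) ∧
    ∃ φ : ℕ → E d → ℝ, (∀ n, ContDiff ℝ ∞ (φ n)) ∧
      Tendsto (fun n => eLpNorm (φ n - q) (3 / 2) (vol (cell κ))) atTop (𝓝 0) ∧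
      Tendsto (fun n => eLpNorm (gradient (φ n) - G) (3 / 2) (vol (cell κ))) atTop (𝓝 0) ∧
      Tendsto (fun n => eLpNorm (φ n - t) (3 / 2) (surf (face κ j))) atTop (𝓝 0)

/-- `v_r ∈ L^3(Ω)^d` is a lifting of the pressure residual of the discrete velocity
`u' = u_h^{i+1}`, formed with the interpolation operator `rh`. The function `t k j` is the trace of
`q` on the face `j` of the element `k`; the interpolant `rh q` is continuous and is its own trace. -/
def IsLifting (rh : (E d → ℝ) → (E d → ℝ)) (u' vr : E d → E d) : Prop :=
  MemX Ω vr ∧ ∀ q G, MemM Ω q G →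
    ∀ t : Fin T.N → Fin (d + 1) → E d → ℝ, (∀ k j, IsTrace (T.elem k) j q G (t k j)) →
      ∫ x in Ω, inner ℝ (G x) (vr x) =
        ∑ k, ((∫ x in cell (T.elem k), (q x - rh q x) * div u' x)
          - ∑ j, ∫ x, T.phi u' k j x * (t k j x - rh q x) ∂(surf (face (T.elem k) j)))

end Triangulation

end

end DarcyForchheimer

namespace DarcyForchheimer

noncomputable section

/-! ### Barycentric coordinates, cells and faces -/

section Simplex

variable {d : ℕ} (κ : AffineBasis (Fin (d + 1)) ℝ (E d))

/-! The first bound is the triangle inequality for `uh (i+1) - uh i = (u - uh i) - (u - uh (i+1))`.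

The second is a bubble-function argument carried out inside a single element. A discrete velocity is
continuous and the outward normals of the elements sharing an interior face cancel
(`sum_inner_normal_eq_zero`), so `phi` vanishes on interior faces and only boundary faces contribute
(`phi_eq`). With Green's formula and the discrete divergence constraint, the total residual vanishes
on every continuous piecewise affine function (`sum_residual_eq_zero`). Hence the interpolant `rh q`
drops out, whatever `rh` is. If `Q` is smooth and vanishes on the faces of an element `κ` not
contained in the boundary of `Ω`, its extension by zero minus its mean lies in `M`, and the lifting
identity reduces to `∫_κ ∇Q · vr = residual(Q)` (`IsLifting.setIntegral_inner_gradient`).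

Two choices of `Q` finish the proof. Element bubble times `div u` makes the residual a weighted
square of `div u` (`exists_div_estimate`). Face bubble times the affine extension of `u · n` from a
boundary face gives a weighted square of `phi` on that face, plus a divergence term already
controlled (`exists_face_estimate`). Each square bounds the coefficients from below, while Hölder
bounds `∫ ∇Q · vr` from above.

The constants are uniform because all these functions are polynomials in the barycentric coordinates
with finitely many coefficients: an affine map sends every simplex to a reference one, where
positivity and compactness give coercivity (`exists_lower_bound`). The shape enters only through `1
≤ ‖∇λ_i‖ h_κ ≤ σ`. Face integrals become integrals over the simplex by Fubini along an edge
(`faceInt_coord_mul`), so no separate scaling theory on faces is needed. -/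

/-- The constant gradient of the `j`-th barycentric coordinate. -/
def coordGrad (j : Fin (d + 1)) : E d := gradient (κ.coord j) (κ j)

theorem hasFDerivAt_coord (j : Fin (d + 1)) (x : E d) :
    HasFDerivAt (κ.coord j) (κ.coord j).linear.toContinuousLinearMap x := by
  have h : (κ.coord j : E d → ℝ)
      = fun y => (κ.coord j).linear.toContinuousLinearMap y + κ.coord j 0 := by
    funext y
    have := congrFun (κ.coord j).decomp y
    simpa using this
  rw [h]
  exact ((κ.coord j).linear.toContinuousLinearMap.hasFDerivAt).add_const _

theorem contDiff_coord (j : Fin (d + 1)) {n : WithTop ℕ∞} : ContDiff ℝ n (κ.coord j) := by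
  have h : (κ.coord j : E d → ℝ)
      = fun y => (κ.coord j).linear.toContinuousLinearMap y + κ.coord j 0 := by
    funext y
    have := congrFun (κ.coord j).decomp y
    simpa using this
  rw [h]
  exact ((κ.coord j).linear.toContinuousLinearMap.contDiff).add contDiff_const

theorem continuous_coord (j : Fin (d + 1)) : Continuous (κ.coord j) :=
  continuous_barycentric_coord κ j

theorem linear_coord_apply (j : Fin (d + 1)) (v : E d) :
    (κ.coord j).linear v = inner ℝ (coordGrad κ j) v := by
  rw [coordGrad, gradient, (hasFDerivAt_coord κ j _).fderiv, InnerProductSpace.toDual_symm_apply]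
  rfl

theorem coord_add (j : Fin (d + 1)) (x v : E d) :
    κ.coord j (x + v) = κ.coord j x + inner ℝ (coordGrad κ j) v := by
  have := (κ.coord j).map_vadd x v
  rw [linear_coord_apply] at this
  simpa [add_comm] using this

theorem inner_coordGrad_sub (i l : Fin (d + 1)) (j : Fin (d + 1)) :
    inner ℝ (coordGrad κ j) (κ i - κ l)
      = (if j = i then 1 else 0) - (if j = l then (1 : ℝ) else 0) := by
  have := coord_add κ j (κ l) (κ i - κ l)
  rw [add_sub_cancel, κ.coord_apply, κ.coord_apply] at this
  linarith

theorem coord_add_smul_sub (i l : Fin (d + 1)) (j : Fin (d + 1)) (x : E d) (s : ℝ) :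
    κ.coord j (x + s • (κ i - κ l))
      = κ.coord j x + s * ((if j = i then 1 else 0) - (if j = l then (1 : ℝ) else 0)) := by
  rw [coord_add, inner_smul_right, inner_coordGrad_sub]

theorem coordGrad_ne_zero {i l : Fin (d + 1)} (h : i ≠ l) : coordGrad κ i ≠ 0 := by
  intro h0
  have := inner_coordGrad_sub κ i l i
  simp [h0, h] at this

theorem cell_eq : cell κ = {x | ∀ i, 0 ≤ κ.coord i x} := κ.convexHull_eq_nonneg_coord

theorem interior_cell : interior (cell κ) = {x | ∀ i, 0 < κ.coord i x} := κ.interior_convexHull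

theorem mem_cell {x : E d} : x ∈ cell κ ↔ ∀ i, 0 ≤ κ.coord i x := by
  rw [cell_eq]; rfl

theorem vertex_mem_cell (i : Fin (d + 1)) : κ i ∈ cell κ :=
  subset_convexHull ℝ _ (mem_range_self i)

theorem coord_le_one {x : E d} (hx : x ∈ cell κ) (i : Fin (d + 1)) : κ.coord i x ≤ 1 := by
  rw [← κ.sum_coord_apply_eq_one x]
  exact Finset.single_le_sum (f := fun i => κ.coord i x) (fun j _ => (mem_cell κ).1 hx j)
    (Finset.mem_univ i)

theorem isCompact_cell : IsCompact (cell κ) := (finite_range κ).isCompact_convexHull ℝ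

theorem convex_cell : Convex ℝ (cell κ) := convex_convexHull ℝ _

theorem measurableSet_cell : MeasurableSet (cell κ) := (isCompact_cell κ).measurableSet

theorem volume_frontier_cell : volume (frontier (cell κ)) = 0 := (convex_cell κ).addHaar_frontier _

theorem nonempty_interior_cell : (interior (cell κ)).Nonempty := by
  refine ⟨Finset.univ.centroid ℝ κ, ?_⟩
  rw [interior_cell]
  intro i
  rw [κ.coord_apply_centroid (Finset.mem_univ i)]
  simp
  positivity

theorem volume_cell_pos : 0 < volume (cell κ) :=
  (isOpen_interior.measure_pos _ (nonempty_interior_cell κ)).trans_le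
    (measure_mono interior_subset)

theorem volume_cell_lt_top : volume (cell κ) < ⊤ := (isCompact_cell κ).measure_lt_top

theorem cell_subset_closure_interior : cell κ ⊆ closure (interior (cell κ)) := by
  rw [(convex_cell κ).closure_interior_eq_closure_of_nonempty_interior (nonempty_interior_cell κ)]
  exact subset_closure

theorem ae_mem_interior_cell : ∀ᵐ x ∂vol (cell κ), x ∈ interior (cell κ) := by
  rw [vol, ae_restrict_iff' (measurableSet_cell κ)]
  filter_upwards [measure_eq_zero_iff_ae_notMem.1 (volume_frontier_cell κ)] with x hx hxc
  by_contra h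
  exact hx ⟨subset_closure hxc, h⟩

theorem face_eq (j : Fin (d + 1)) : face κ j = {x ∈ cell κ | κ.coord j x = 0} := by
  apply Subset.antisymm
  · refine convexHull_min ?_ ?_
    · rintro _ ⟨i, hi, rfl⟩
      exact ⟨vertex_mem_cell κ i, κ.coord_apply_ne (Ne.symm hi)⟩
    · refine (convex_cell κ).inter ?_
      have := (convex_singleton (𝕜 := ℝ) (0 : ℝ)).affine_preimage (κ.coord j)
      exact this
  · rintro x ⟨hx, hj⟩
    have h1 : ∑ i ∈ Finset.univ.erase j, κ.coord i x = 1 := by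
      rw [← κ.sum_coord_apply_eq_one x, ← Finset.add_sum_erase _ _ (Finset.mem_univ j), hj, zero_add]
    have h2 : ∑ i ∈ Finset.univ.erase j, κ.coord i x • κ i = x := by
      conv_rhs => rw [← κ.linear_combination_coord_eq_self x]
      rw [← Finset.add_sum_erase _ _ (Finset.mem_univ j), hj, zero_smul, zero_add]
    rw [← h2]
    refine (convex_convexHull ℝ _).sum_mem (fun i _ => (mem_cell κ).1 hx i) h1 ?_
    intro i hi
    exact subset_convexHull ℝ _ ⟨i, by simpa using Finset.ne_of_mem_erase hi, rfl⟩

theorem face_subset_cell (j : Fin (d + 1)) : face κ j ⊆ cell κ := by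
  rw [face_eq]; exact sep_subset _ _

theorem coord_eq_zero_of_mem_face {j : Fin (d + 1)} {x : E d} (hx : x ∈ face κ j) :
    κ.coord j x = 0 := by
  rw [face_eq] at hx; exact hx.2

theorem isCompact_face (j : Fin (d + 1)) : IsCompact (face κ j) :=
  ((finite_range κ).subset (image_subset_range _ _)).isCompact_convexHull ℝ

theorem measurableSet_face (j : Fin (d + 1)) : MeasurableSet (face κ j) :=
  (isCompact_face κ j).measurableSet

/-! ### Hyperplane measures -/

/-- The surface measure on the hyperplane carrying the face `j`, scaled by the height of the
simplex over that face. -/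
def faceMeasure (j : Fin (d + 1)) : Measure (E d) :=
  ‖coordGrad κ j‖ₑ⁻¹ • (Measure.euclideanHausdorffMeasure (d - 1)).restrict {x | κ.coord j x = 0}

theorem ae_faceMeasure (j : Fin (d + 1)) : ∀ᵐ x ∂faceMeasure κ j, κ.coord j x = 0 := by
  refine Measure.ae_smul_measure ?_ _
  exact ae_restrict_mem ((continuous_coord κ j).measurable (measurableSet_singleton 0))

/-- The hyperplane is a translate of the orthogonal complement of `∇λ_j`, so Hausdorff measure on it
is an isometric image of Lebesgue measure. S-finiteness and finiteness on compact sets are inherited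
from there. -/
theorem map_vadd_orthogonal (j : Fin (d + 1)) {l : Fin (d + 1)} (h : j ≠ l) :
    Measure.map (fun y : (ℝ ∙ coordGrad κ j)ᗮ => (y : E d) + κ l) volume
      = (Measure.euclideanHausdorffMeasure (d - 1)).restrict {x | κ.coord j x = 0} := by
  have hr : Module.finrank ℝ (ℝ ∙ coordGrad κ j)ᗮ = d - 1 := by
    have := (ℝ ∙ coordGrad κ j).finrank_add_finrank_orthogonal
    rw [finrank_span_singleton (coordGrad_ne_zero κ h)] at this
    simp at this
    omega
  have hi : Isometry (fun y : (ℝ ∙ coordGrad κ j)ᗮ => (y : E d) + κ l) := by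
    refine Isometry.of_dist_eq fun x y => ?_
    simp [Subtype.dist_eq]
  rw [← InnerProductSpace.euclideanHausdorffMeasure_eq_volume, hr, hi.map_euclideanHausdorffMeasure]
  congr 1
  ext x
  simp only [mem_range, Subtype.exists, mem_ofPred_eq]
  have key : κ.coord j x = inner ℝ (coordGrad κ j) (x - κ l) := by
    have := coord_add κ j (κ l) (x - κ l)
    rwa [add_sub_cancel, κ.coord_apply_ne h, zero_add] at this
  constructor
  · rintro ⟨y, hy, rfl⟩
    rw [key, add_sub_cancel_right]
    exact Submodule.mem_orthogonal_singleton_iff_inner_right.1 hy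
  · intro hx
    refine ⟨x - κ l, ?_, by simp⟩
    rw [Submodule.mem_orthogonal_singleton_iff_inner_right, ← key, hx]

instance instSFiniteFaceMeasure [NeZero d] (j : Fin (d + 1)) : SFinite (faceMeasure κ j) := by
  have : Nontrivial (Fin (d + 1)) := Fin.nontrivial_iff_two_le.2 (by have := NeZero.pos d; omega)
  obtain ⟨l, hl⟩ := exists_ne j
  rw [faceMeasure, ← map_vadd_orthogonal κ j hl.symm]
  infer_instance

theorem faceMeasure_lt_top [NeZero d] (j : Fin (d + 1)) {K : Set (E d)} (hK : IsCompact K) :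
    faceMeasure κ j K < ⊤ := by
  have : Nontrivial (Fin (d + 1)) := Fin.nontrivial_iff_two_le.2 (by have := NeZero.pos d; omega)
  obtain ⟨l, hl⟩ := exists_ne j
  have hcl : IsClosedEmbedding (fun y : (ℝ ∙ coordGrad κ j)ᗮ => (y : E d) + κ l) := by
    have hi : Isometry (fun y : (ℝ ∙ coordGrad κ j)ᗮ => (y : E d) + κ l) := by
      refine Isometry.of_dist_eq fun x y => ?_
      simp [Subtype.dist_eq]
    exact hi.isClosedEmbedding
  rw [faceMeasure, ← map_vadd_orthogonal κ j hl.symm, Measure.smul_apply, smul_eq_mul,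
    Measure.map_apply hcl.continuous.measurable hK.measurableSet]
  refine ENNReal.mul_lt_top ?_ (hcl.isCompact_preimage hK).measure_lt_top
  simp [coordGrad_ne_zero κ hl.symm]

theorem surf_face [NeZero d] (j : Fin (d + 1)) :
    surf (face κ j) = ‖coordGrad κ j‖ₑ • (faceMeasure κ j).restrict (face κ j) := by
  have : Nontrivial (Fin (d + 1)) := Fin.nontrivial_iff_two_le.2 (by have := NeZero.pos d; omega)
  obtain ⟨l, hl⟩ := exists_ne j
  rw [faceMeasure, Measure.restrict_smul, smul_smul, ENNReal.mul_inv_cancel, one_smul,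
    Measure.restrict_restrict (measurableSet_face κ j), inter_eq_left.2, surf]
  · intro x hx; exact coord_eq_zero_of_mem_face κ hx
  · simpa using coordGrad_ne_zero κ hl.symm
  · simp

theorem isFiniteMeasure_faceMeasure_restrict [NeZero d] (j : Fin (d + 1)) :
    IsFiniteMeasure ((faceMeasure κ j).restrict (face κ j)) :=
  ⟨by rw [Measure.restrict_apply_univ]; exact faceMeasure_lt_top κ j (isCompact_face κ j)⟩

/-- Lebesgue measure disintegrates along the lines parallel to the edge from vertex `l` to
vertex `i` over the hyperplane opposite to vertex `i`. -/
theorem map_prod_faceMeasure [NeZero d] {i l : Fin (d + 1)} (h : i ≠ l) :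
    Measure.map (fun z : ℝ × E d => z.2 + z.1 • (κ i - κ l)) (volume.prod (faceMeasure κ i))
      = volume := by
  have hg := coordGrad_ne_zero κ h
  set g := coordGrad κ i with hgdef
  ext t ht
  have hm : Measurable (fun z : ℝ × E d => z.2 + z.1 • (κ i - κ l)) := by fun_prop
  rw [Measure.map_apply hm ht, Measure.prod_apply (hm ht)]
  have hgn : ‖g‖ ≠ 0 := norm_ne_zero_iff.2 hg
  -- This normal vector is scaled so that `λ_i` grows by exactly 1 along it. Its length `‖g‖⁻¹` is
  -- the height built into `faceMeasure`.
  have hv : (‖g‖ ^ 2)⁻¹ • g ≠ 0 := smul_ne_zero (by positivity) hg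
  have key := EuclideanGeometry.euclideanHausdorffMeasure_eq_lintegral (κ l) hv ht
  rw [InnerProductSpace.euclideanHausdorffMeasure_eq_volume, finrank_euclideanSpace_fin] at key
  rw [key, ← lintegral_const_mul' _ _ (by simp)]
  refine lintegral_congr fun s => ?_
  have hn : ‖(‖g‖ ^ 2)⁻¹ • g‖ₑ = ‖g‖ₑ⁻¹ := by
    have h1 : ‖(‖g‖ ^ 2)⁻¹ • g‖ = ‖g‖⁻¹ := by
      rw [norm_smul, norm_inv, norm_pow, norm_norm]
      field_simp
    rw [← ofReal_norm, h1, ENNReal.ofReal_inv_of_pos (by positivity), ofReal_norm]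
  rw [hn, faceMeasure, Measure.smul_apply, smul_eq_mul]
  congr 1
  have hs : MeasurableSet (Prod.mk s ⁻¹' ((fun z : ℝ × E d => z.2 + z.1 • (κ i - κ l)) ⁻¹' t)) :=
    measurable_prodMk_left (hm ht)
  rw [Measure.restrict_apply hs]
  symm
  -- The level set `λ_i = s` is reached along the edge instead of along the normal. The two
  -- displacements differ by a vector tangent to the hyperplane, and Hausdorff measure is
  -- translation invariant.
  rw [← measure_preimage_add_right _ (s • (κ i - κ l))]
  congr 1
  ext y
  have h1 : inner ℝ ((‖g‖ ^ 2)⁻¹ • g) (y + s • (κ i - κ l) - (s • (‖g‖ ^ 2)⁻¹ • g + κ l)) = 0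
      ↔ κ.coord i y = 0 := by
    have h2 := coord_add κ i (κ l) (y - κ l)
    rw [add_sub_cancel, κ.coord_apply_ne h, zero_add, ← hgdef] at h2
    have h3 : y + s • (κ i - κ l) - (s • (‖g‖ ^ 2)⁻¹ • g + κ l)
        = (y - κ l) + s • (κ i - κ l) - s • (‖g‖ ^ 2)⁻¹ • g := by abel
    have h4 : inner ℝ g (κ i - κ l) = (1 : ℝ) := by
      rw [hgdef, inner_coordGrad_sub]; simp [h]
    rw [h3, inner_smul_left, inner_sub_right, inner_add_right, ← h2, inner_smul_right,
      inner_smul_right, inner_smul_right, h4, real_inner_self_eq_norm_sq]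
    simp [hg]
  simp only [mem_preimage, mem_inter_iff, mem_ofPred_eq, SetLike.mem_coe, AffineSubspace.mem_mk',
    vadd_eq_add, vsub_eq_sub, Submodule.mem_orthogonal_singleton_iff_inner_right, h1]


end Simplex

/-! ### Fubini along an edge and the divergence theorem on a simplex. -/

section Simplex

variable {d : ℕ} (κ : AffineBasis (Fin (d + 1)) ℝ (E d))

/-- Sliding along the edge from vertex `l` to vertex `i` maps the hyperplane measure opposite to
vertex `i` onto the one opposite to vertex `l`. -/
theorem map_slide_faceMeasure [NeZero d] {i l : Fin (d + 1)} (h : i ≠ l) :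
    Measure.map (fun y => y + κ.coord l y • (κ i - κ l)) (faceMeasure κ i) = faceMeasure κ l := by
  set w := κ i - κ l with hw
  have hc : ∀ j, Measurable (κ.coord j) := fun j => (continuous_coord κ j).measurable
  have hπ : Measurable (fun y => y + κ.coord l y • w) := by have := hc l; fun_prop
  have hm : Measurable (fun z : ℝ × E d => z.2 + z.1 • w) := by fun_prop
  have hm' : Measurable (fun z : ℝ × E d => z.2 + z.1 • (κ l - κ i)) := by fun_prop
  ext A hA
  rw [Measure.map_apply hπ hA]
  -- The point `x + λ_l(x) w` is constant along lines parallel to `w`, so `t` is a union of segments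
  -- on which `λ_i` runs through `[0, 1]`. Every segment has parameter length 1 seen from either
  -- hyperplane, and computing `volume t` by Fubini from both sides compares the two measures.
  set t : Set (E d) := {x | x + κ.coord l x • w ∈ A ∧ κ.coord i x ∈ Icc (0 : ℝ) 1} with htdef
  have ht : MeasurableSet t := (hπ hA).inter (hc i measurableSet_Icc)
  have e1 : volume t = faceMeasure κ i ((fun y => y + κ.coord l y • w) ⁻¹' A) := by
    rw [← map_prod_faceMeasure κ h, Measure.map_apply hm ht, Measure.prod_apply_symm (hm ht),
      ← lintegral_indicator_one (hπ hA)]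
    refine lintegral_congr_ae ?_
    filter_upwards [ae_faceMeasure κ i] with y hy
    have hset : (fun s : ℝ => (s, y)) ⁻¹' ((fun z : ℝ × E d => z.2 + z.1 • w) ⁻¹' t)
        = {s | y + κ.coord l y • w ∈ A ∧ s ∈ Icc (0 : ℝ) 1} := by
      ext s
      have h1 : y + s • w + (κ.coord l y + s * (0 - 1)) • w = y + κ.coord l y • w := by
        rw [add_assoc, ← add_smul]; congr 2; ring
      simp only [htdef, mem_preimage, mem_ofPred_eq, hw, coord_add_smul_sub, hy]
      rw [← hw]
      simp only [h.symm, h, if_true, if_false, h1]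
      simp
    rw [hset]
    by_cases hyA : y + κ.coord l y • w ∈ A
    · have : (y : E d) ∈ (fun y => y + κ.coord l y • w) ⁻¹' A := hyA
      have hI : {s : ℝ | s ∈ Icc (0 : ℝ) 1} = Icc 0 1 := by ext; simp
      simp only [hyA, true_and, indicator_of_mem this, hI]
      simp
    · have : (y : E d) ∉ (fun y => y + κ.coord l y • w) ⁻¹' A := hyA
      rw [indicator_of_notMem this]
      simp [hyA]
  have e2 : volume t = faceMeasure κ l A := by
    rw [← map_prod_faceMeasure κ h.symm, Measure.map_apply hm' ht, Measure.prod_apply_symm (hm' ht),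
      ← lintegral_indicator_one hA]
    refine lintegral_congr_ae ?_
    filter_upwards [ae_faceMeasure κ l] with y hy
    have hset : (fun s : ℝ => (s, y)) ⁻¹' ((fun z : ℝ × E d => z.2 + z.1 • (κ l - κ i)) ⁻¹' t)
        = {s | y ∈ A ∧ s ∈ Icc (κ.coord i y - 1) (κ.coord i y)} := by
      ext s
      have h1 : y + s • (κ l - κ i) + (0 + s * (1 - 0)) • w = y := by
        rw [hw]; module
      simp only [htdef, mem_preimage, mem_ofPred_eq, coord_add_smul_sub, hy]
      simp only [h.symm, h, if_true, if_false, h1, mem_Icc]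
      constructor <;> rintro ⟨h1, h2, h3⟩ <;> refine ⟨h1, ?_, ?_⟩ <;> linarith
    rw [hset]
    have hI : {s : ℝ | s ∈ Icc (κ.coord i y - 1) (κ.coord i y)}
        = Icc (κ.coord i y - 1) (κ.coord i y) := by ext; simp
    by_cases hyA : y ∈ A
    · simp only [hyA, true_and, hI, indicator_of_mem hyA]
      simp
    · simp [hyA]
  rw [← e1, e2]

/-- The scaled integral of a function over the face `j`. -/
def faceInt (j : Fin (d + 1)) (f : E d → ℝ) : ℝ := ∫ x in face κ j, f x ∂faceMeasure κ j

theorem integral_surf_face [NeZero d] (j : Fin (d + 1)) (f : E d → ℝ) :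
    ∫ x, f x ∂surf (face κ j) = ‖coordGrad κ j‖ * faceInt κ j f := by
  rw [surf_face, integral_smul_measure, faceInt]
  simp

/-- Moving along the edge transfers weight from `λ_l` to `λ_i` and fixes the other coordinates, so
the line leaves the simplex exactly when `λ_l` is used up. -/
theorem slide_mem_cell_iff {i l : Fin (d + 1)} (h : i ≠ l) {y : E d} (hy : κ.coord i y = 0)
    (s : ℝ) : y + s • (κ i - κ l) ∈ cell κ ↔ y ∈ face κ i ∧ s ∈ Icc 0 (κ.coord l y) := by
  simp only [face_eq, mem_cell, mem_ofPred_eq, coord_add_smul_sub, mem_Icc]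
  constructor
  · intro H
    have h1 := H i
    have h2 := H l
    simp only [h, h.symm, hy, if_true, if_false] at h1 h2
    have h3 : 0 ≤ s := by linarith
    refine ⟨⟨fun j => ?_, hy⟩, h3, by linarith⟩
    have hj := H j
    by_cases hji : j = i
    · subst hji; exact hy.ge
    by_cases hjl : j = l
    · subst hjl; linarith
    simpa [hji, hjl] using hj
  · rintro ⟨⟨H, -⟩, h3, h4⟩ j
    have hj := H j
    by_cases hji : j = i
    · subst hji; simp [h, hy, h3]
    by_cases hjl : j = l
    · subst hjl; simp [hji]; linarith
    simpa [hji, hjl] using hj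

/-- Fubini's theorem on a simplex, along one of its edges. -/
theorem setIntegral_cell [NeZero d] {i l : Fin (d + 1)} (h : i ≠ l) {F : E d → ℝ}
    (hF : Continuous F) :
    ∫ x in cell κ, F x
      = faceInt κ i (fun y => ∫ s in (0 : ℝ)..κ.coord l y, F (y + s • (κ i - κ l))) := by
  have hm : Measurable (fun z : ℝ × E d => z.2 + z.1 • (κ i - κ l)) := by fun_prop
  have hint : Integrable ((cell κ).indicator F) :=
    (integrable_indicator_iff (measurableSet_cell κ)).2
      (hF.continuousOn.integrableOn_compact (isCompact_cell κ))
  have hint' := hint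
  rw [← map_prod_faceMeasure κ h] at hint'
  rw [← integral_indicator (measurableSet_cell κ), ← map_prod_faceMeasure κ h,
    integral_map hm.aemeasurable hint'.aestronglyMeasurable,
    integral_prod_symm (fun z : ℝ × E d => (cell κ).indicator F (z.2 + z.1 • (κ i - κ l)))
      (hint'.comp_aemeasurable hm.aemeasurable), faceInt,
    ← integral_indicator (measurableSet_face κ i)]
  refine integral_congr_ae ?_
  filter_upwards [ae_faceMeasure κ i] with y hy
  by_cases hyf : y ∈ face κ i
  · rw [indicator_of_mem hyf]
    have h0 : 0 ≤ κ.coord l y := (mem_cell κ).1 (face_subset_cell κ i hyf) l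
    rw [intervalIntegral.integral_of_le h0, ← integral_Icc_eq_integral_Ioc,
      ← integral_indicator measurableSet_Icc]
    congr 1
    funext s
    have := slide_mem_cell_iff κ h hy s
    by_cases hs : s ∈ Icc 0 (κ.coord l y)
    · rw [indicator_of_mem hs, indicator_of_mem (this.2 ⟨hyf, hs⟩)]
    · rw [indicator_of_notMem hs, indicator_of_notMem fun h' => hs (this.1 h').2]
  · rw [indicator_of_notMem hyf]
    refine integral_eq_zero_of_ae (ae_of_all _ fun s => ?_)
    exact indicator_of_notMem (fun h' => hyf ((slide_mem_cell_iff κ h hy s).1 h').1) _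

theorem integrable_face [NeZero d] (j : Fin (d + 1)) {f : E d → ℝ}
    (hf : ContinuousOn f (face κ j)) : IntegrableOn f (face κ j) (faceMeasure κ j) := by
  have := isFiniteMeasure_faceMeasure_restrict κ j
  obtain ⟨C, hC⟩ := (isCompact_face κ j).exists_bound_of_continuousOn hf
  exact Integrable.of_bound (hf.aestronglyMeasurable (measurableSet_face κ j)) C
    ((ae_restrict_iff' (measurableSet_face κ j)).2 (ae_of_all _ hC))

theorem faceInt_slide [NeZero d] {i l : Fin (d + 1)} (h : i ≠ l) {f : E d → ℝ}
    (hf : Continuous f) :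
    faceInt κ i (fun y => f (y + κ.coord l y • (κ i - κ l))) = faceInt κ l f := by
  have hc := continuous_coord κ l
  have hπ : Measurable (fun y => y + κ.coord l y • (κ i - κ l)) := by
    have := hc.measurable; fun_prop
  rw [faceInt, faceInt, ← integral_indicator (measurableSet_face κ i),
    ← integral_indicator (measurableSet_face κ l), ← map_slide_faceMeasure κ h,
    integral_map hπ.aemeasurable (hf.measurable.indicator (measurableSet_face κ l)).aestronglyMeasurable]
  refine integral_congr_ae ?_
  filter_upwards [ae_faceMeasure κ i] with y hy
  -- The pushforward identity concerns whole hyperplanes; this matches the faces within them.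
  have hiff : y + κ.coord l y • (κ i - κ l) ∈ face κ l ↔ y ∈ face κ i := by
    have h1 : κ.coord l (y + κ.coord l y • (κ i - κ l)) = 0 := by
      rw [coord_add_smul_sub]; simp [h.symm]
    have h2 : y + κ.coord l y • (κ i - κ l) ∈ face κ l
        ↔ y + κ.coord l y • (κ i - κ l) ∈ cell κ := by
      rw [face_eq]; exact and_iff_left h1
    rw [h2, slide_mem_cell_iff κ h hy]
    refine and_iff_left_of_imp fun hyf => ?_
    have h0 : 0 ≤ κ.coord l y := (mem_cell κ).1 (face_subset_cell κ i hyf) l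
    exact ⟨h0, le_rfl⟩
  by_cases hyf : y ∈ face κ i
  · rw [indicator_of_mem hyf, indicator_of_mem (hiff.2 hyf)]
  · rw [indicator_of_notMem hyf, indicator_of_notMem (fun h' => hyf (hiff.1 h'))]

/-- The divergence theorem on a simplex, in the direction of an edge. -/
theorem setIntegral_fderiv_edge [NeZero d] {i l : Fin (d + 1)} (h : i ≠ l) {f : E d → ℝ}
    (hf : ContDiff ℝ 1 f) :
    ∫ x in cell κ, fderiv ℝ f x (κ i - κ l) = faceInt κ l f - faceInt κ i f := by
  have hc := continuous_coord κ l
  rw [setIntegral_cell κ h ((hf.continuous_fderiv one_ne_zero).clm_apply continuous_const),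
    ← faceInt_slide κ h hf.continuous, faceInt, faceInt, faceInt, ← integral_sub]
  · congr 1
    funext y
    -- Fundamental theorem of calculus on each segment parallel to the edge: it starts on face `i`
    -- at `s = 0` and ends on face `l` at `s = λ_l(y)`.
    have hd : ∀ s : ℝ, HasDerivAt (fun s : ℝ => f (y + s • (κ i - κ l)))
        (fderiv ℝ f (y + s • (κ i - κ l)) (κ i - κ l)) s := by
      intro s
      have h1 : HasDerivAt (fun s : ℝ => y + s • (κ i - κ l)) (κ i - κ l) s := by
        simpa using ((hasDerivAt_id s).smul_const (κ i - κ l)).const_add y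
      exact ((hf.differentiable one_ne_zero).differentiableAt.hasFDerivAt).comp_hasDerivAt s h1
    rw [intervalIntegral.integral_eq_sub_of_hasDerivAt (fun s _ => hd s)]
    · simp
    · apply Continuous.intervalIntegrable
      have := hf.continuous_fderiv one_ne_zero
      fun_prop
  · exact integrable_face κ i (by have := hf.continuous; fun_prop)
  · exact integrable_face κ i hf.continuous.continuousOn

theorem affine_eq_sum {F : Type*} [AddCommGroup F] [Module ℝ F] (A : E d →ᵃ[ℝ] F) (x : E d) :
    A x = ∑ i, κ.coord i x • A (κ i) := by
  have hw := κ.sum_coord_apply_eq_one x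
  have := Finset.univ.map_affineCombination κ (fun i => κ.coord i x) hw A
  rw [κ.affineCombination_coord_eq_self x] at this
  rw [this, Finset.affineCombination_eq_linear_combination _ _ _ hw]
  rfl

theorem eq_sum_edges (v : E d) :
    v = ∑ i, inner ℝ (coordGrad κ i) v • (κ i - κ 0) := by
  have h1 := κ.linear_combination_coord_eq_self v
  have h2 := κ.linear_combination_coord_eq_self (0 : E d)
  have h3 : ∀ i, inner ℝ (coordGrad κ i) v = κ.coord i v - κ.coord i 0 := by
    intro i
    have := coord_add κ i 0 v
    rw [zero_add] at this
    linarith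
  have h4 := κ.sum_coord_apply_eq_one v
  have h5 := κ.sum_coord_apply_eq_one (0 : E d)
  simp only [h3, smul_sub, sub_smul, Finset.sum_sub_distrib, h1, h2, ← Finset.sum_smul, h4, h5]
  simp

theorem sum_inner_coordGrad (v : E d) : ∑ i, inner ℝ (coordGrad κ i) v = 0 := by
  have h3 : ∀ i, inner ℝ (coordGrad κ i) v = κ.coord i v - κ.coord i 0 := by
    intro i
    have := coord_add κ i 0 v
    rw [zero_add] at this
    linarith
  simp only [h3, Finset.sum_sub_distrib, κ.sum_coord_apply_eq_one, sub_self]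

/-- The divergence theorem on a simplex for a constant direction, in terms of the gradients of the
barycentric coordinates. -/
theorem setIntegral_fderiv_cell [NeZero d] {f : E d → ℝ} (hf : ContDiff ℝ 1 f) (v : E d) :
    ∫ x in cell κ, fderiv ℝ f x v = - ∑ j, inner ℝ (coordGrad κ j) v * faceInt κ j f := by
  have hcont := hf.continuous_fderiv one_ne_zero
  have e1 : ∀ x, fderiv ℝ f x v
      = ∑ i, inner ℝ (coordGrad κ i) v * fderiv ℝ f x (κ i - κ 0) := by
    intro x
    conv_lhs => rw [eq_sum_edges κ v]
    simp only [map_sum, map_smul, smul_eq_mul]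
  simp only [e1]
  rw [integral_finsetSum]
  · have e2 : ∀ i, ∫ x in cell κ, inner ℝ (coordGrad κ i) v * fderiv ℝ f x (κ i - κ 0)
        = inner ℝ (coordGrad κ i) v * (faceInt κ 0 f - faceInt κ i f) := by
      intro i
      rw [integral_const_mul]
      by_cases hi : i = 0
      · subst hi; simp
      · rw [setIntegral_fderiv_edge κ hi hf]
    -- The contributions of face `0` cancel because the gradients of the barycentric coordinates sum
    -- to zero.
    simp only [e2, mul_sub, Finset.sum_sub_distrib, ← Finset.sum_mul, sum_inner_coordGrad]
    simp
  · intro i _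
    exact (by fun_prop : Continuous _).continuousOn.integrableOn_compact (isCompact_cell κ)

theorem integral_surf_mul_normal [NeZero d] (j : Fin (d + 1)) (v : E d) (f : E d → ℝ) :
    ∫ x, f x * inner ℝ v (normal κ j) ∂surf (face κ j)
      = - (inner ℝ (coordGrad κ j) v * faceInt κ j f) := by
  have : Nontrivial (Fin (d + 1)) := Fin.nontrivial_iff_two_le.2 (by have := NeZero.pos d; omega)
  obtain ⟨l, hl⟩ := exists_ne j
  have hg := norm_ne_zero_iff.2 (coordGrad_ne_zero κ hl.symm)
  have e : normal κ j = -(‖coordGrad κ j‖⁻¹ • coordGrad κ j) := rfl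
  rw [integral_mul_const, integral_surf_face, e, inner_neg_right, inner_smul_right,
    real_inner_comm]
  field_simp

/-- The moment identity relating integrals over a face and over the simplex. -/
theorem faceInt_coord_mul [NeZero d] {i l : Fin (d + 1)} (h : i ≠ l) {g : E d → ℝ}
    (hg : Continuous g) :
    faceInt κ i (fun y => κ.coord l y * g y)
      = ∫ x in cell κ, g (x - κ.coord i x • (κ i - κ l)) := by
  have hc := continuous_coord κ i
  -- The argument of `g` is the projection onto the hyperplane along the edge. It is constant on
  -- each segment, so the inner integral only produces the segment length `λ_l`.
  rw [setIntegral_cell κ h (by fun_prop), faceInt, faceInt]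
  refine setIntegral_congr_fun (measurableSet_face κ i) fun y hy => ?_
  have h0 := coord_eq_zero_of_mem_face κ hy
  simp [coord_add_smul_sub, h0, h]

/-- The scaled area of every face is `d` times the volume of the simplex. -/
theorem faceInt_one [NeZero d] (i : Fin (d + 1)) :
    faceInt κ i (fun _ => 1) = d * volume.real (cell κ) := by
  -- On the face the `d` remaining coordinates sum to 1, and the moment identity turns each of them
  -- into one copy of the volume.
  have e : faceInt κ i (fun _ => 1)
      = faceInt κ i (fun y => ∑ l ∈ Finset.univ.erase i, κ.coord l y * 1) := by
    refine setIntegral_congr_fun (measurableSet_face κ i) fun y hy => ?_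
    have h0 := coord_eq_zero_of_mem_face κ hy
    have := κ.sum_coord_apply_eq_one y
    rw [← Finset.add_sum_erase _ _ (Finset.mem_univ i), h0, zero_add] at this
    simp [this]
  rw [e, faceInt, integral_finsetSum]
  · have : ∀ l ∈ Finset.univ.erase i,
        ∫ y in face κ i, κ.coord l y * 1 ∂faceMeasure κ i = volume.real (cell κ) := by
      intro l hl
      have := faceInt_coord_mul κ (Finset.ne_of_mem_erase hl).symm (g := fun _ => 1)
        continuous_const
      rw [faceInt] at this
      rw [this]
      simp
    rw [Finset.sum_congr rfl this]
    simp
  · intro l _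
    have := continuous_coord κ l
    exact integrable_face κ i (by fun_prop)

end Simplex

/-! ### Green's formula, and smooth representatives of discrete functions on an element. -/

section Simplex

variable {d : ℕ} (κ : AffineBasis (Fin (d + 1)) ℝ (E d))

theorem integral_surf_mul_inner_normal [NeZero d] (j : Fin (d + 1)) (s : E d → ℝ) (V : E d → E d) :
    ∫ x, s x * inner ℝ (V x) (normal κ j) ∂surf (face κ j)
      = - faceInt κ j (fun x => s x * inner ℝ (coordGrad κ j) (V x)) := by
  have : Nontrivial (Fin (d + 1)) := Fin.nontrivial_iff_two_le.2 (by have := NeZero.pos d; omega)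
  obtain ⟨l, hl⟩ := exists_ne j
  have hg := norm_ne_zero_iff.2 (coordGrad_ne_zero κ hl.symm)
  have e : normal κ j = -(‖coordGrad κ j‖⁻¹ • coordGrad κ j) := rfl
  have e2 : ∀ x, s x * inner ℝ (V x) (normal κ j)
      = (-‖coordGrad κ j‖⁻¹) * (s x * inner ℝ (coordGrad κ j) (V x)) := by
    intro x
    rw [e, inner_neg_right, inner_smul_right, real_inner_comm]
    ring
  simp only [e2]
  rw [integral_const_mul, integral_surf_face]
  field_simp

theorem fderiv_apply_eq_inner_gradient (s : E d → ℝ) (x v : E d) :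
    fderiv ℝ s x v = inner ℝ (gradient s x) v := by
  rw [gradient, InnerProductSpace.toDual_symm_apply]

theorem continuous_gradient {s : E d → ℝ} (h : ContDiff ℝ 1 s) : Continuous (gradient s) := by
  have h1 : gradient s = fun x => (InnerProductSpace.toDual ℝ (E d)).symm (fderiv ℝ s x) := rfl
  have := h.continuous_fderiv one_ne_zero
  rw [h1]
  fun_prop

theorem continuous_div {V : E d → E d} (h : ContDiff ℝ 1 V) : Continuous (div V) := by
  have := h.continuous_fderiv one_ne_zero
  unfold div
  fun_prop

/-- Green's formula on a simplex. -/
theorem setIntegral_mul_div [NeZero d] {s : E d → ℝ} {V : E d → E d} (hs : ContDiff ℝ 1 s)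
    (hV : ContDiff ℝ 1 V) :
    ∫ x in cell κ, s x * div V x
      = ∑ j, (∫ x, s x * inner ℝ (V x) (normal κ j) ∂surf (face κ j))
        - ∫ x in cell κ, inner ℝ (gradient s x) (V x) := by
  have hVa : ∀ a, ContDiff ℝ 1 (fun x => V x a) := fun a => by fun_prop
  have hdV := hV.continuous_fderiv one_ne_zero
  have hds := hs.continuous_fderiv one_ne_zero
  have hsc := hs.continuous
  have hVc := hV.continuous
  have hf : ∀ a, ContDiff ℝ 1 (fun x => s x * V x a) := fun a => hs.mul (hVa a)
  -- Product rule: the directional formula is applied to `s V_a` in the direction `e_a` and summed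
  -- over `a`.
  have hpt : ∀ x, ∑ a, fderiv ℝ (fun x => s x * V x a) x (EuclideanSpace.single a 1)
      = s x * div V x + inner ℝ (gradient s x) (V x) := by
    intro x
    have h1 : ∀ a, fderiv ℝ (fun x => s x * V x a) x (EuclideanSpace.single a 1)
        = s x * (fderiv ℝ V x (EuclideanSpace.single a 1)) a
          + V x a * fderiv ℝ s x (EuclideanSpace.single a 1) := by
      intro a
      have hsx : DifferentiableAt ℝ s x := (hs.differentiable one_ne_zero).differentiableAt
      have hVx : DifferentiableAt ℝ V x := (hV.differentiable one_ne_zero).differentiableAt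
      have hVxa : DifferentiableAt ℝ (fun x => V x a) x :=
        ((hVa a).differentiable one_ne_zero).differentiableAt
      have h2 : HasFDerivAt (fun x => V x a) ((EuclideanSpace.proj a : E d →L[ℝ] ℝ).comp
          (fderiv ℝ V x)) x :=
        (EuclideanSpace.proj a : E d →L[ℝ] ℝ).hasFDerivAt.comp x hVx.hasFDerivAt
      rw [fderiv_fun_mul hsx hVxa, h2.fderiv]
      simp
    simp only [h1, Finset.sum_add_distrib, div, Finset.mul_sum]
    congr 1
    rw [← fderiv_apply_eq_inner_gradient]
    conv_rhs => rw [← (EuclideanSpace.basisFun (Fin d) ℝ).sum_repr (V x)]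
    simp
  have hi : ∀ {F : E d → ℝ}, Continuous F → IntegrableOn F (cell κ) := fun hF =>
    hF.continuousOn.integrableOn_compact (isCompact_cell κ)
  have hgc := continuous_gradient hs
  have hdc := continuous_div hV
  rw [eq_sub_iff_add_eq, ← integral_add (hi (by fun_prop)) (hi (by fun_prop))]
  simp only [← hpt]
  rw [integral_finsetSum]
  · simp only [setIntegral_fderiv_cell κ (hf _), integral_surf_mul_inner_normal,
      Finset.sum_neg_distrib]
    rw [Finset.sum_comm]
    congr 1
    refine Finset.sum_congr rfl fun j _ => ?_
    have h3 : ∀ x, s x * inner ℝ (coordGrad κ j) (V x)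
        = ∑ a, inner ℝ (coordGrad κ j) (EuclideanSpace.single a (1 : ℝ)) * (s x * V x a) := by
      intro x
      rw [PiLp.inner_apply, Finset.mul_sum]
      refine Finset.sum_congr rfl fun a _ => ?_
      rw [EuclideanSpace.inner_single_right]
      simp
      ring
    simp only [h3]
    simp only [faceInt]
    rw [integral_finsetSum]
    · simp only [integral_const_mul]
    · intro a _
      exact integrable_face κ j (by fun_prop)
  · intro a _
    have := (hf a).continuous_fderiv one_ne_zero
    exact hi (by fun_prop)

/-- If the smooth function `s` vanishes on the boundary of a simplex, its derivatives have mean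
value zero there. -/
theorem setIntegral_fderiv_eq_zero [NeZero d] {s : E d → ℝ} (hs : ContDiff ℝ 1 s)
    (h : ∀ j, ∀ x ∈ face κ j, s x = 0) (v : E d) : ∫ x in cell κ, fderiv ℝ s x v = 0 := by
  rw [setIntegral_fderiv_cell κ hs, neg_eq_zero]
  refine Finset.sum_eq_zero fun j _ => ?_
  rw [faceInt, setIntegral_congr_fun (measurableSet_face κ j) (g := fun _ => 0)
    (fun x hx => h j x hx)]
  simp

theorem gradient_congr_interior {s t : E d → ℝ} {K : Set (E d)} (h : EqOn s t K) {x : E d}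
    (hx : x ∈ interior K) : gradient s x = gradient t x := by
  have : s =ᶠ[𝓝 x] t := by
    filter_upwards [mem_interior_iff_mem_nhds.1 hx] with y hy using h hy
  rw [gradient, gradient, this.fderiv_eq]

theorem div_congr_interior {s t : E d → E d} {K : Set (E d)} (h : EqOn s t K) {x : E d}
    (hx : x ∈ interior K) : div s x = div t x := by
  have : s =ᶠ[𝓝 x] t := by
    filter_upwards [mem_interior_iff_mem_nhds.1 hx] with y hy using h hy
  rw [div, div, this.fderiv_eq]

theorem contDiff_affine (A : E d →ᵃ[ℝ] ℝ) {n : WithTop ℕ∞} : ContDiff ℝ n A := by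
  have h : (A : E d → ℝ) = fun y => A.linear.toContinuousLinearMap y + A 0 := by
    funext y
    simpa using congrFun A.decomp y
  rw [h]
  exact (A.linear.toContinuousLinearMap.contDiff).add contDiff_const

theorem contDiff_affine_vec (A : E d →ᵃ[ℝ] E d) {n : WithTop ℕ∞} : ContDiff ℝ n A := by
  have h : (A : E d → E d) = fun y => A.linear.toContinuousLinearMap y + A 0 := by
    funext y
    simpa using congrFun A.decomp y
  rw [h]
  exact (A.linear.toContinuousLinearMap.contDiff).add contDiff_const

theorem contDiff_bubble {n : WithTop ℕ∞} : ContDiff ℝ n (bubble κ) := by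
  unfold bubble
  exact contDiff_prod fun j _ => contDiff_coord κ j

theorem contDiff_affine_add_bubble (A : E d →ᵃ[ℝ] E d) (c : E d) {n : WithTop ℕ∞} :
    ContDiff ℝ n (fun x => A x + bubble κ x • c) :=
  (contDiff_affine_vec A).add ((contDiff_bubble κ).smul contDiff_const)

theorem bubble_eq_zero_of_mem_face {j : Fin (d + 1)} {x : E d} (hx : x ∈ face κ j) :
    bubble κ x = 0 :=
  Finset.prod_eq_zero (Finset.mem_univ j) (coord_eq_zero_of_mem_face κ hx)

end Simplex

/-! ### Geometry of the triangulation -/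

namespace Triangulation

variable {d : ℕ} {Ω : Set (E d)} (T : Triangulation Ω)

theorem cell_subset_closure (k : Fin T.N) : cell (T.elem k) ⊆ closure Ω := by
  rw [← T.cover]
  exact subset_iUnion (fun i => cell (T.elem i)) k

/-- The cover only places cells in the closure of `Ω`, which would allow slits. The Lipschitz graph
excludes them: from a boundary point in the interior of a cell, a small step along `ν` stays in the
cell but lands strictly above the graph, away from the closure of `Ω`. -/
theorem interior_cell_subset (hΩ : IsOpen Ω) (hL : HasLipschitzBoundary Ω) (k : Fin T.N) :
    interior (cell (T.elem k)) ⊆ Ω := by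
  intro x hx
  by_contra hxΩ
  have hxc : x ∈ closure Ω := T.cell_subset_closure k (interior_subset hx)
  have hxf : x ∈ frontier Ω := by
    rw [hΩ.frontier_eq]; exact ⟨hxc, hxΩ⟩
  obtain ⟨U, hU, ν, hν, L, g, hg, hinv, hiff⟩ := hL x hxf
  have hxU : x ∈ U := mem_of_mem_nhds hU
  have hge : g x ≤ inner ℝ x ν := not_lt.1 fun h => hxΩ ((hiff x hxU).2 h)
  have hnb : interior (cell (T.elem k)) ∩ interior U ∈ 𝓝 x :=
    inter_mem (isOpen_interior.mem_nhds hx) (interior_mem_nhds.2 hU)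
  have hcont : Tendsto (fun t : ℝ => x + t • ν) (𝓝[>] 0) (𝓝 x) := by
    have : Continuous (fun t : ℝ => x + t • ν) := by fun_prop
    have h := this.tendsto 0
    simp only [zero_smul, add_zero] at h
    exact h.mono_left nhdsWithin_le_nhds
  obtain ⟨t, ht, ht0⟩ := ((hcont.eventually hnb).and self_mem_nhdsWithin).exists
  have ht0 : 0 < t := ht0
  set y := x + t • ν with hy
  have hyc : y ∈ closure Ω := T.cell_subset_closure k (interior_subset ht.1)
  have hW : {z | g z < inner ℝ z ν} ∩ interior U ∈ 𝓝 y := by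
    refine inter_mem (IsOpen.mem_nhds ?_ ?_) (isOpen_interior.mem_nhds ht.2)
    · exact isOpen_lt hg.continuous (by fun_prop)
    · change g y < inner ℝ y ν
      rw [hy, hinv, inner_add_left, inner_smul_left, real_inner_self_eq_norm_sq, hν]
      simp
      linarith
  obtain ⟨z, hz, hzΩ⟩ := mem_closure_iff_nhds.1 hyc _ hW
  have h1 : inner ℝ z ν < g z := (hiff z (interior_subset hz.2)).1 hzΩ
  have h2 : g z < inner ℝ z ν := hz.1
  linarith

/-- The boundary is covered by the frontiers of finitely many convex cells, because their interiors
lie in the open set `Ω`. -/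
theorem volume_frontier (T : Triangulation Ω) (hΩ : IsOpen Ω) (hL : HasLipschitzBoundary Ω) :
    volume (frontier Ω) = 0 := by
  refine measure_mono_null (t := ⋃ k, frontier (cell (T.elem k))) ?_
    (measure_iUnion_null fun k => volume_frontier_cell _)
  intro x hx
  have hxc : x ∈ ⋃ i, cell (T.elem i) := by
    rw [T.cover]; exact frontier_subset_closure hx
  obtain ⟨k, hk⟩ := mem_iUnion.1 hxc
  refine mem_iUnion.2 ⟨k, subset_closure hk, fun hi => ?_⟩
  rw [hΩ.frontier_eq] at hx
  exact hx.2 (T.interior_cell_subset hΩ hL k hi)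

/-- This is how conformity is used: a common point is a combination of common vertices, so any
vertex carrying nonzero weight at it is shared. -/
theorem vertex_mem_range {k k' : Fin T.N} {x : E d} (hx : x ∈ cell (T.elem k))
    (hx' : x ∈ cell (T.elem k')) {i : Fin (d + 1)} (hi : (T.elem k).coord i x ≠ 0) :
    T.elem k i ∈ range (T.elem k') := by
  by_cases hkk : k = k'
  · subst hkk; exact mem_range_self i
  by_contra hn
  have hmem : x ∈ convexHull ℝ (range (T.elem k) ∩ range (T.elem k')) := by
    rw [← T.conforming k k' hkk]; exact ⟨hx, hx'⟩
  have hsub : range (T.elem k) ∩ range (T.elem k') ⊆ T.elem k '' {i}ᶜ := by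
    rintro _ ⟨⟨m, rfl⟩, hm⟩
    refine ⟨m, ?_, rfl⟩
    rintro rfl
    exact hn hm
  exact hi (coord_eq_zero_of_mem_face (T.elem k) (convexHull_mono hsub hmem))

/-- Distinct elements have different vertex sets of equal size, so one vertex of the first is not
shared. Its coordinate vanishes on the intersection, which therefore lies in the frontier of the
first cell. -/
theorem aedisjoint_cell : Pairwise (Function.onFun (AEDisjoint volume) fun k => cell (T.elem k)) := by
  intro k k' hkk
  have hex : ∃ i, T.elem k i ∉ range (T.elem k') := by
    by_contra hall
    push Not at hall
    refine hkk (T.distinct k k' ?_)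
    have hfin : (range (T.elem k')).Finite := finite_range _
    refine eq_of_subset_of_ncard_le (range_subset_iff.2 hall) ?_ hfin
    rw [← image_univ, ← image_univ, ncard_image_of_injective _ (T.elem k).ind.injective,
      ncard_image_of_injective _ (T.elem k').ind.injective]
  obtain ⟨i, hi⟩ := hex
  refine measure_mono_null (t := frontier (cell (T.elem k))) ?_ (volume_frontier_cell _)
  rintro x ⟨hx, hx'⟩
  refine ⟨subset_closure hx, fun hint => ?_⟩
  rw [interior_cell] at hint
  exact hi (T.vertex_mem_range hx hx' (hint i).ne')

theorem vol_eq_sum (hΩ : IsOpen Ω) (hL : HasLipschitzBoundary Ω) :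
    vol Ω = Measure.sum fun k => vol (cell (T.elem k)) := by
  have h1 : vol Ω = vol (closure Ω) := by
    refine Measure.restrict_congr_set ?_
    rw [closure_eq_self_union_frontier]
    refine (union_ae_eq_left_of_ae_eq_empty ?_).symm
    exact ae_eq_empty.2 (T.volume_frontier hΩ hL)
  rw [h1, ← T.cover]
  exact Measure.restrict_iUnion_ae T.aedisjoint_cell
    fun k => (measurableSet_cell _).nullMeasurableSet

theorem setIntegral_eq_sum (hΩ : IsOpen Ω) (hL : HasLipschitzBoundary Ω) {F : Type*}
    [NormedAddCommGroup F] [NormedSpace ℝ F] {f : E d → F}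
    (hf : ∀ k, IntegrableOn f (cell (T.elem k))) :
    ∫ x in Ω, f x = ∑ k, ∫ x in cell (T.elem k), f x := by
  have h := T.vol_eq_sum hΩ hL
  rw [Measure.sum_fintype] at h
  change ∫ x, f x ∂vol Ω = _
  rw [h, integral_finsetSum_measure]
  intro k _
  exact hf k

theorem vol_cell_le (hΩ : IsOpen Ω) (hL : HasLipschitzBoundary Ω) (k : Fin T.N) :
    vol (cell (T.elem k)) ≤ vol Ω := by
  rw [T.vol_eq_sum hΩ hL]
  exact Measure.le_sum (fun k => vol (cell (T.elem k))) k

theorem vol_patch_le (hΩ : IsOpen Ω) (hL : HasLipschitzBoundary Ω) (k : Fin T.N) :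
    vol (T.patch k) ≤ vol Ω := by
  have h1 : vol Ω = vol (closure Ω) := by
    refine Measure.restrict_congr_set ?_
    rw [closure_eq_self_union_frontier]
    refine (union_ae_eq_left_of_ae_eq_empty ?_).symm
    exact ae_eq_empty.2 (T.volume_frontier hΩ hL)
  rw [h1]
  refine Measure.restrict_mono ?_ le_rfl
  exact iUnion₂_subset fun k' _ => T.cell_subset_closure k'

theorem cell_subset_patch (k : Fin T.N) : cell (T.elem k) ⊆ T.patch k := by
  refine subset_iUnion₂_of_subset k ?_ subset_rfl
  change (cell (T.elem k) ∩ cell (T.elem k)).Nonempty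
  rw [inter_self]
  exact ⟨_, vertex_mem_cell _ 0⟩

/-- A face containing a relatively interior point of another face coincides with it. -/
theorem face_eq_face {k k' : Fin T.N} {j j' : Fin (d + 1)} {x : E d}
    (hx : x ∈ face (T.elem k) j) (hpos : ∀ i ≠ j, 0 < (T.elem k).coord i x)
    (hx' : x ∈ face (T.elem k') j') : face (T.elem k') j' = face (T.elem k) j := by
  have hxc := face_subset_cell _ _ hx
  have hxc' := face_subset_cell _ _ hx'
  have hsub : T.elem k '' {j}ᶜ ⊆ T.elem k' '' {j'}ᶜ := by
    rintro _ ⟨i, hi, rfl⟩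
    have hi : i ≠ j := hi
    obtain ⟨m, hm⟩ := T.vertex_mem_range hxc hxc' (hpos i hi).ne'
    refine ⟨m, ?_, hm⟩
    rintro rfl
    -- The coordinate `λ'_m` vanishes at `x`, a combination with positive weights of vertices at
    -- which it is nonnegative. Hence it vanishes at each of them, including the one where it equals
    -- 1.
    have h1 : (T.elem k').coord m x
        = ∑ i, (T.elem k).coord i x * (T.elem k').coord m (T.elem k i) :=
      affine_eq_sum (T.elem k) ((T.elem k').coord m) x
    rw [coord_eq_zero_of_mem_face _ hx'] at h1
    have h2 : ∀ l ∈ Finset.univ,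
        0 ≤ (T.elem k).coord l x * (T.elem k').coord m (T.elem k l) := by
      intro l _
      by_cases hl : l = j
      · subst hl; rw [coord_eq_zero_of_mem_face _ hx, zero_mul]
      · obtain ⟨n, hn⟩ := T.vertex_mem_range hxc hxc' (hpos l hl).ne'
        rw [← hn]
        exact mul_nonneg (hpos l hl).le ((mem_cell _).1 (vertex_mem_cell _ n) m)
    have h3 := (Finset.sum_eq_zero_iff_of_nonneg h2).1 h1.symm i (Finset.mem_univ i)
    rw [← hm, AffineBasis.coord_apply_eq, mul_one] at h3
    exact (hpos i hi).ne' h3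
  have heq : T.elem k '' {j}ᶜ = T.elem k' '' {j'}ᶜ := by
    refine eq_of_subset_of_ncard_le hsub ?_ (toFinite _)
    rw [ncard_image_of_injective _ (T.elem k).ind.injective,
      ncard_image_of_injective _ (T.elem k').ind.injective, ncard_compl, ncard_compl]
    simp
  rw [face, face, heq]

end Triangulation

/-! ### Positivity of volume and surface integrals, and integrals of derivatives of test functions.
-/

section Simplex

variable {d : ℕ} (κ : AffineBasis (Fin (d + 1)) ℝ (E d))

theorem setIntegral_cell_pos {f : E d → ℝ} (hf : Continuous f) (h0 : ∀ x ∈ cell κ, 0 ≤ f x)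
    {x : E d} (hx : x ∈ cell κ) (hfx : 0 < f x) : 0 < ∫ x in cell κ, f x := by
  rw [setIntegral_pos_iff_support_of_nonneg_ae
    ((ae_restrict_iff' (measurableSet_cell κ)).2 (ae_of_all _ h0))
    (hf.continuousOn.integrableOn_compact (isCompact_cell κ))]
  have ho : IsOpen (f ⁻¹' Ioi 0) := isOpen_Ioi.preimage hf
  have hne : (f ⁻¹' Ioi 0 ∩ interior (cell κ)).Nonempty :=
    mem_closure_iff.1 (cell_subset_closure_interior κ hx) _ ho hfx
  refine ((ho.inter isOpen_interior).measure_pos volume hne).trans_le (measure_mono ?_)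
  rintro y ⟨hy, hyi⟩
  exact ⟨(ne_of_gt hy : f y ≠ 0), interior_subset hyi⟩

theorem integral_fderiv_eq_zero {φ : E d → ℝ} (h : ContDiff ℝ 1 φ) (hc : HasCompactSupport φ)
    (v : E d) : ∫ x, fderiv ℝ φ x v = 0 := by
  have hd := h.continuous_fderiv one_ne_zero
  have hcont : Continuous fun x => fderiv ℝ φ x v := by fun_prop
  have h1 : Integrable fun x => fderiv ℝ φ x v := hcont.integrable_of_hasCompactSupport
    (hc.fderiv_apply ℝ v)
  have := integral_mul_fderiv_eq_neg_fderiv_mul_of_integrable (μ := (volume : Measure (E d)))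
    (f := fun _ => (1 : ℝ)) (g := φ) (v := v) (by simp) (by simpa using h1)
    (by simpa using h.continuous.integrable_of_hasCompactSupport hc)
    (fun x _ => differentiableAt_const _) (fun x _ => (h.differentiable one_ne_zero).differentiableAt)
  simpa using this

theorem setIntegral_fderiv_of_tsupport {Ω : Set (E d)} {φ : E d → ℝ} (h : ContDiff ℝ 1 φ)
    (hc : HasCompactSupport φ) (hs : tsupport φ ⊆ Ω) (v : E d) :
    ∫ x in Ω, fderiv ℝ φ x v = 0 := by
  rw [setIntegral_eq_integral_of_forall_compl_eq_zero, integral_fderiv_eq_zero h hc]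
  intro x hx
  have : x ∉ tsupport (fderiv ℝ φ) := fun h' => hx (hs (tsupport_fderiv_subset ℝ h'))
  rw [image_eq_zero_of_notMem_tsupport this]
  rfl

theorem isFiniteMeasure_surf_face [NeZero d] (j : Fin (d + 1)) :
    IsFiniteMeasure (surf (face κ j)) := by
  have := isFiniteMeasure_faceMeasure_restrict κ j
  rw [surf_face]
  exact Measure.smul_finite _ (by simp)

theorem ae_surf_mem (j : Fin (d + 1)) : ∀ᵐ x ∂surf (face κ j), x ∈ face κ j :=
  ae_restrict_mem (measurableSet_face κ j)

theorem integrable_surf [NeZero d] (j : Fin (d + 1)) {F : Type*} [NormedAddCommGroup F]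
    {f : E d → F} (hf : ContinuousOn f (face κ j)) : Integrable f (surf (face κ j)) := by
  have := isFiniteMeasure_surf_face κ j
  obtain ⟨C, hC⟩ := (isCompact_face κ j).exists_bound_of_continuousOn hf
  exact Integrable.of_bound
    (hf.aestronglyMeasurable_of_isCompact (isCompact_face κ j) (measurableSet_face κ j)) C
    ((ae_surf_mem κ j).mono hC)

theorem exists_pos_on_face [NeZero d] (j : Fin (d + 1)) :
    ∃ y ∈ face κ j, ∀ i ≠ j, 0 < κ.coord i y := by
  have hne : (Finset.univ.erase j : Finset (Fin (d + 1))).Nonempty := by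
    rw [← Finset.card_pos]; simp; exact NeZero.pos d
  have h1 : ∀ i ≠ j, 0 < κ.coord i ((Finset.univ.erase j).centroid ℝ κ) := by
    intro i hi
    rw [κ.coord_apply_centroid (Finset.mem_erase.2 ⟨hi, Finset.mem_univ i⟩)]
    have := Finset.card_pos.2 hne
    positivity
  have h2 : κ.coord j ((Finset.univ.erase j).centroid ℝ κ) = 0 :=
    κ.coord_apply_combination_of_notMem (Finset.notMem_erase j _)
      (Finset.sum_centroidWeights_eq_one_of_nonempty ℝ _ hne)
  refine ⟨_, ?_, h1⟩
  rw [face_eq]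
  refine ⟨(mem_cell κ).2 fun i => ?_, h2⟩
  by_cases hi : i = j
  · rw [hi, h2]
  · exact (h1 i hi).le

/-- The weight `λ_l ≤ 1` only lowers the integral, and the moment identity turns the weighted face
integral into a volume integral of a continuous nonnegative function that is positive at `x`. -/
theorem integral_surf_pos [NeZero d] (j : Fin (d + 1)) {f : E d → ℝ} (hf : Continuous f)
    (h0 : ∀ x, 0 ≤ f x) {x : E d} (hx : x ∈ face κ j) (hfx : 0 < f x) :
    0 < ∫ y, f y ∂surf (face κ j) := by
  have : Nontrivial (Fin (d + 1)) := Fin.nontrivial_iff_two_le.2 (by have := NeZero.pos d; omega)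
  obtain ⟨l, hl⟩ := exists_ne j
  rw [integral_surf_face]
  refine mul_pos (norm_pos_iff.2 (coordGrad_ne_zero κ hl.symm)) ?_
  have hc := continuous_coord κ l
  have hc' := continuous_coord κ j
  have h1 : faceInt κ j (fun y => κ.coord l y * f y) ≤ faceInt κ j f := by
    refine setIntegral_mono_on (integrable_face κ j (by fun_prop))
      (integrable_face κ j (by fun_prop)) (measurableSet_face κ j) fun y hy => ?_
    exact mul_le_of_le_one_left (h0 y) (coord_le_one κ (face_subset_cell κ j hy) l)
  refine lt_of_lt_of_le ?_ h1
  rw [faceInt_coord_mul κ hl.symm hf]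
  refine setIntegral_cell_pos κ (by fun_prop) (fun y _ => h0 _) (face_subset_cell κ j hx) ?_
  rw [coord_eq_zero_of_mem_face κ hx]
  simpa using hfx

end Simplex

/-! ### Cancellation of normals on interior faces, and the pressure residual. -/

namespace Triangulation

variable {d : ℕ} {Ω : Set (E d)} (T : Triangulation Ω)

/-- The centroid of the face might itself lie on the boundary of `Ω`. A point of the face in `Ω` is
instead moved slightly towards it, staying in the open set `Ω` while all the required coordinates
become positive. -/
theorem exists_pos_on_interior_face [NeZero d] (hΩ : IsOpen Ω) {k : Fin T.N} {j : Fin (d + 1)}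
    (h : ¬ face (T.elem k) j ⊆ frontier Ω) :
    ∃ y ∈ face (T.elem k) j, y ∈ Ω ∧ ∀ i ≠ j, 0 < (T.elem k).coord i y := by
  obtain ⟨x, hx, hxf⟩ := not_subset.1 h
  have hxΩ : x ∈ Ω := by
    by_contra hn
    rw [hΩ.frontier_eq] at hxf
    exact hxf ⟨T.cell_subset_closure k (face_subset_cell _ _ hx), hn⟩
  obtain ⟨y, hy, hpos⟩ := exists_pos_on_face (T.elem k) j
  have hcont : Tendsto (fun t : ℝ => AffineMap.lineMap x y t) (𝓝[>] 0) (𝓝 x) := by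
    have h1 : Continuous (fun t : ℝ => AffineMap.lineMap x y t) := AffineMap.lineMap_continuous
    have h2 := h1.tendsto 0
    rw [AffineMap.lineMap_apply_zero] at h2
    exact h2.mono_left nhdsWithin_le_nhds
  have hlt : ∀ᶠ t : ℝ in 𝓝[>] 0, t < 1 :=
    nhdsWithin_le_nhds (gt_mem_nhds one_pos)
  obtain ⟨t, ht, ht0, ht1⟩ :=
    ((hcont.eventually (hΩ.mem_nhds hxΩ)).and
      (Filter.Eventually.and (self_mem_nhdsWithin (a := (0 : ℝ)) (s := Ioi 0)) hlt)).exists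
  have ht0 : 0 < t := ht0
  refine ⟨_, ?_, ht, fun i hi => ?_⟩
  · have hcv : Convex ℝ (face (T.elem k) j) := convex_convexHull ℝ _
    exact hcv.lineMap_mem hx hy ⟨ht0.le, ht1.le⟩
  · rw [AffineMap.apply_lineMap, AffineMap.lineMap_apply_module]
    have h1 := (mem_cell _).1 (face_subset_cell _ _ hx) i
    have h2 := hpos i hi
    have h3 : 0 < 1 - t := by linarith
    simp only [smul_eq_mul]
    positivity

open Classical in
/-- The outward normals of the elements sharing an interior face add up to zero. -/
theorem sum_inner_normal_eq_zero [NeZero d] (hΩ : IsOpen Ω) (hL : HasLipschitzBoundary Ω)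
    {k : Fin T.N} {j : Fin (d + 1)} (h : ¬ face (T.elem k) j ⊆ frontier Ω) (v : E d) :
    ∑ k', ∑ j', (if face (T.elem k') j' = face (T.elem k) j then
      inner ℝ v (normal (T.elem k') j') else 0) = 0 := by
  obtain ⟨x, hx, hxΩ, hpos⟩ := T.exists_pos_on_interior_face hΩ h
  -- `F` collects all faces different from the given one. A bump function supported in `Ω` away from
  -- `F` sees only this face, so the elementwise divergence theorem, together with `∫_Ω ∂_v ψ = 0`,
  -- isolates the sum of normals times `∫ ψ > 0`. There is no need to count the elements sharing the
  -- face.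
  set F : Set (E d) := ⋃ k', ⋃ j', {y | y ∈ face (T.elem k') j' ∧
    face (T.elem k') j' ≠ face (T.elem k) j} with hF
  have hFc : IsClosed F := by
    refine isClosed_iUnion_of_finite fun k' => isClosed_iUnion_of_finite fun j' => ?_
    by_cases hne : face (T.elem k') j' = face (T.elem k) j
    · simp [hne]
    · simpa [hne] using (isCompact_face (T.elem k') j').isClosed
  have hxF : x ∉ F := by
    intro hxF
    simp only [hF, mem_iUnion, mem_ofPred_eq] at hxF
    obtain ⟨k', j', hx', hne⟩ := hxF
    exact hne (T.face_eq_face hx hpos hx')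
  obtain ⟨ψ, hψs, hψc, hψ, hψr, hψx⟩ := exists_contDiff_tsupport_subset (n := ⊤)
    ((hΩ.inter hFc.isOpen_compl).mem_nhds ⟨hxΩ, hxF⟩)
  have hψ1 : ContDiff ℝ 1 ψ := hψ.of_le (by simp)
  have h0 : ∀ y, 0 ≤ ψ y := fun y => (hψr (mem_range_self y)).1
  have hzero : ∫ x in Ω, fderiv ℝ ψ x v = 0 :=
    setIntegral_fderiv_of_tsupport hψ1 hψc (hψs.trans inter_subset_left) v
  have hcont : Continuous fun x => fderiv ℝ ψ x v := by
    have := hψ1.continuous_fderiv one_ne_zero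
    fun_prop
  rw [T.setIntegral_eq_sum hΩ hL
    (fun k => hcont.continuousOn.integrableOn_compact (isCompact_cell _))] at hzero
  have hI : 0 < ∫ y, ψ y ∂surf (face (T.elem k) j) :=
    integral_surf_pos _ j hψ.continuous h0 hx (by rw [hψx]; exact one_pos)
  refine (mul_eq_zero.1 (?_ : (∫ y, ψ y ∂surf (face (T.elem k) j)) * _ = 0)).resolve_left hI.ne'
  refine Eq.trans ?_ hzero
  rw [Finset.mul_sum]
  refine Finset.sum_congr rfl fun k' _ => ?_
  rw [setIntegral_fderiv_cell _ hψ1, Finset.mul_sum, ← Finset.sum_neg_distrib]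
  refine Finset.sum_congr rfl fun j' _ => ?_
  rw [← integral_surf_mul_normal, integral_mul_const]
  by_cases he : face (T.elem k') j' = face (T.elem k) j
  · rw [if_pos he, he]
  · rw [if_neg he, mul_zero, integral_eq_zero_of_ae, zero_mul]
    filter_upwards [ae_surf_mem (T.elem k') j'] with y hy
    refine image_eq_zero_of_notMem_tsupport fun hy' => (hψs hy').2 ?_
    simp only [hF, mem_iUnion, mem_ofPred_eq]
    exact ⟨k', j', hy, he⟩

/-- The value of `φ_{h,1}` for a continuous velocity. -/
theorem phi_eq [NeZero d] (hΩ : IsOpen Ω) (hL : HasLipschitzBoundary Ω) {u : E d → E d}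
    (hu : ContinuousOn u (closure Ω)) {k : Fin T.N} {j : Fin (d + 1)} {x : E d}
    (hx : x ∈ face (T.elem k) j) [Decidable (face (T.elem k) j ⊆ frontier Ω)] :
    T.phi u k j x
      = if face (T.elem k) j ⊆ frontier Ω then inner ℝ (u x) (normal (T.elem k) j) else 0 := by
  classical
  by_cases h : face (T.elem k) j ⊆ frontier Ω
  · simp only [phi, h, if_true]
  · simp only [phi, h, if_false]
    -- By continuity every one-sided limit equals `u x`, so the jump is the vanishing sum of normals
    -- tested with `u x`.
    have : T.jump u k j x = 0 := by
      rw [← T.sum_inner_normal_eq_zero hΩ hL h (u x), jump]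
      refine Finset.sum_congr rfl fun k' _ => Finset.sum_congr rfl fun j' _ => ?_
      by_cases he : face (T.elem k') j' = face (T.elem k) j
      · rw [if_pos he, if_pos he]
        rw [← he] at hx
        have hxc := face_subset_cell _ _ hx
        rw [extendFrom_eq (cell_subset_closure_interior _ hxc)]
        exact (hu x (T.cell_subset_closure k' hxc)).mono_left
          (nhdsWithin_mono _ (interior_subset.trans (T.cell_subset_closure k')))
      · rw [if_neg he, if_neg he]
    rw [this, mul_zero]

/-- The contribution of the element `k` to the pressure residual tested with `s`. -/
def residual (u : E d → E d) (k : Fin T.N) (s : E d → ℝ) : ℝ :=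
  (∫ x in cell (T.elem k), s x * div u x)
    - ∑ j, ∫ x, T.phi u k j x * s x ∂(surf (face (T.elem k) j))

theorem MemP1.contDiff {T : Triangulation Ω} {s : E d → ℝ} (hs : T.MemP1 s) (k : Fin T.N) :
    ∃ s' : E d → ℝ, ContDiff ℝ ∞ s' ∧ EqOn s s' (cell (T.elem k)) := by
  obtain ⟨A, hA⟩ := hs.2 k
  exact ⟨A, contDiff_affine A, hA⟩

theorem MemXh.contDiff {T : Triangulation Ω} {u : E d → E d} (hu : T.MemXh u) (k : Fin T.N) :
    ∃ V : E d → E d, ContDiff ℝ ∞ V ∧ EqOn u V (cell (T.elem k)) := by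
  obtain ⟨A, c, hA⟩ := hu.2 k
  exact ⟨_, contDiff_affine_add_bubble _ A c, hA⟩

theorem ae_div_eq {k : Fin T.N} {u V : E d → E d} (h : EqOn u V (cell (T.elem k))) :
    ∀ᵐ x ∂vol (cell (T.elem k)), div u x = div V x :=
  (ae_mem_interior_cell _).mono fun _ hx => div_congr_interior h hx

theorem ae_gradient_eq {k : Fin T.N} {s t : E d → ℝ} (h : EqOn s t (cell (T.elem k))) :
    ∀ᵐ x ∂vol (cell (T.elem k)), gradient s x = gradient t x :=
  (ae_mem_interior_cell _).mono fun _ hx => gradient_congr_interior h hx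

theorem integrableOn_mul_div {u : E d → E d} (hu : T.MemXh u) {k : Fin T.N} {s : E d → ℝ}
    (hs : ContinuousOn s (cell (T.elem k))) :
    IntegrableOn (fun x => s x * div u x) (cell (T.elem k)) := by
  obtain ⟨V, hV, huV⟩ := hu.contDiff k
  have hd := continuous_div (hV.of_le (by simp))
  have h1 : IntegrableOn (fun x => s x * div V x) (cell (T.elem k)) :=
    (hs.mul hd.continuousOn).integrableOn_compact (isCompact_cell _)
  refine h1.congr ?_
  filter_upwards [T.ae_div_eq huV] with x hx
  rw [hx]

theorem integrable_phi_mul [NeZero d] (hΩ : IsOpen Ω) (hL : HasLipschitzBoundary Ω) {u : E d → E d}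
    (hu : T.MemXh u) {k : Fin T.N} (j : Fin (d + 1)) {s : E d → ℝ}
    (hs : ContinuousOn s (cell (T.elem k))) :
    Integrable (fun x => T.phi u k j x * s x) (surf (face (T.elem k) j)) := by
  classical
  have hsub := (face_subset_cell (T.elem k) j)
  have huf : ContinuousOn u (face (T.elem k) j) := hu.1.mono (hsub.trans (T.cell_subset_closure k))
  by_cases h : face (T.elem k) j ⊆ frontier Ω
  · have h1 : Integrable (fun x => inner ℝ (u x) (normal (T.elem k) j) * s x)
        (surf (face (T.elem k) j)) :=
      integrable_surf _ j ((huf.inner continuousOn_const).mul (hs.mono hsub))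
    refine h1.congr ?_
    filter_upwards [ae_surf_mem (T.elem k) j] with x hx
    rw [T.phi_eq hΩ hL hu.1 hx, if_pos h]
  · refine (integrable_zero _ _ _).congr ?_
    filter_upwards [ae_surf_mem (T.elem k) j] with x hx
    rw [T.phi_eq hΩ hL hu.1 hx, if_neg h, zero_mul]
    rfl

theorem residual_sub [NeZero d] (hΩ : IsOpen Ω) (hL : HasLipschitzBoundary Ω) {u : E d → E d}
    (hu : T.MemXh u) {k : Fin T.N} {s t : E d → ℝ} (hs : ContinuousOn s (cell (T.elem k)))
    (ht : ContinuousOn t (cell (T.elem k))) :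
    T.residual u k (fun x => s x - t x) = T.residual u k s - T.residual u k t := by
  simp only [residual, sub_mul, mul_sub]
  rw [integral_sub (T.integrableOn_mul_div hu hs) (T.integrableOn_mul_div hu ht)]
  simp only [integral_sub (T.integrable_phi_mul hΩ hL hu _ hs)
    (T.integrable_phi_mul hΩ hL hu _ ht), Finset.sum_sub_distrib]
  ring

/-- Green's formula on an element for discrete functions. -/
theorem setIntegral_mul_div_eq [NeZero d] {u : E d → E d} (hu : T.MemXh u) {s : E d → ℝ}
    (hs : T.MemP1 s) (k : Fin T.N) :
    ∫ x in cell (T.elem k), s x * div u x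
      = ∑ j, (∫ x, s x * inner ℝ (u x) (normal (T.elem k) j) ∂surf (face (T.elem k) j))
        - ∫ x in cell (T.elem k), inner ℝ (gradient s x) (u x) := by
  obtain ⟨V, hV, huV⟩ := hu.contDiff k
  obtain ⟨s', hs', hss'⟩ := hs.contDiff k
  have key := setIntegral_mul_div (T.elem k) (hs'.of_le (by simp)) (hV.of_le (by simp))
  have e1 : ∫ x in cell (T.elem k), s x * div u x = ∫ x in cell (T.elem k), s' x * div V x := by
    refine integral_congr_ae ?_
    filter_upwards [T.ae_div_eq huV, ae_restrict_mem (measurableSet_cell _)] with x hx hxc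
    rw [hx, hss' hxc]
  have e2 : ∫ x in cell (T.elem k), inner ℝ (gradient s x) (u x)
      = ∫ x in cell (T.elem k), inner ℝ (gradient s' x) (V x) := by
    refine integral_congr_ae ?_
    filter_upwards [T.ae_gradient_eq hss', ae_restrict_mem (measurableSet_cell _)] with x hx hxc
    rw [hx, huV hxc]
  rw [e1, e2, key]
  congr 1
  refine Finset.sum_congr rfl fun j _ => ?_
  refine integral_congr_ae ?_
  filter_upwards [ae_surf_mem (T.elem k) j] with x hx
  have hxc := face_subset_cell _ _ hx
  rw [hss' hxc, huV hxc]

end Triangulation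

namespace Triangulation

variable {d : ℕ} {Ω : Set (E d)} (T : Triangulation Ω)

theorem integrableOn_inner_gradient {u : E d → E d} (hu : T.MemXh u) {s : E d → ℝ}
    (hs : T.MemP1 s) (k : Fin T.N) :
    IntegrableOn (fun x => inner ℝ (gradient s x) (u x)) (cell (T.elem k)) := by
  obtain ⟨V, hV, huV⟩ := hu.contDiff k
  obtain ⟨s', hs', hss'⟩ := hs.contDiff k
  have hd := continuous_gradient (hs'.of_le (by simp))
  have hc := hV.continuous
  have h1 : IntegrableOn (fun x => inner ℝ (gradient s' x) (V x)) (cell (T.elem k)) :=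
    (by fun_prop : Continuous _).continuousOn.integrableOn_compact (isCompact_cell _)
  refine h1.congr ?_
  filter_upwards [T.ae_gradient_eq hss', ae_restrict_mem (measurableSet_cell _)] with x hx hxc
  rw [hx, huV hxc]

theorem MemP1.sub_const {T : Triangulation Ω} {s : E d → ℝ} (hs : T.MemP1 s) (c : ℝ) :
    T.MemP1 (fun x => s x - c) := by
  refine ⟨hs.1.sub continuousOn_const, fun k => ?_⟩
  obtain ⟨A, hA⟩ := hs.2 k
  refine ⟨A - AffineMap.const ℝ (E d) c, fun x hx => ?_⟩
  simp [hA hx]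

theorem integrableOn_of_continuousOn_closure (hb : Bornology.IsBounded Ω) {F : Type*}
    [NormedAddCommGroup F] {s : E d → F} (hs : ContinuousOn s (closure Ω)) : IntegrableOn s Ω :=
  (hs.integrableOn_compact hb.isCompact_closure).mono_set subset_closure

/-- A discrete velocity that is weakly divergence free with respect to `M_h` is orthogonal to the
gradients of all continuous piecewise affine functions. -/
theorem setIntegral_inner_gradient_eq_zero (hb : Bornology.IsBounded Ω) {u : E d → E d}
    (hdiv : ∀ q, T.MemMh q → ∫ x in Ω, inner ℝ (gradient q x) (u x) = 0) {s : E d → ℝ}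
    (hs : T.MemP1 s) : ∫ x in Ω, inner ℝ (gradient s x) (u x) = 0 := by
  by_cases h0 : volume Ω = 0
  · rw [Measure.restrict_eq_zero.2 h0, integral_zero_measure]
  have hfin : volume Ω ≠ ⊤ := hb.measure_lt_top.ne
  -- The constraint is only known for mean-zero functions; removing the mean does not change the
  -- gradient.
  set c := (volume.real Ω)⁻¹ * ∫ x in Ω, s x with hc
  have hr : volume.real Ω ≠ 0 := (measureReal_ne_zero_iff hfin).2 h0
  have hq : T.MemMh (fun x => s x - c) := by
    refine ⟨hs.sub_const c, ?_⟩
    rw [integral_sub (integrableOn_of_continuousOn_closure hb hs.1) (integrableOn_const hfin)]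
    simp only [setIntegral_const, smul_eq_mul]
    rw [hc]
    field_simp
    ring
  have := hdiv _ hq
  have hg : ∀ x, gradient (fun x => s x - c) x = gradient s x := by
    intro x
    rw [gradient, gradient, fderiv_sub_const]
  simpa only [hg] using this

/-- The total pressure residual vanishes on continuous piecewise affine functions. -/
theorem sum_residual_eq_zero [NeZero d] (hΩ : IsOpen Ω) (hb : Bornology.IsBounded Ω)
    (hL : HasLipschitzBoundary Ω) {u : E d → E d} (hu : T.MemXh u)
    (hdiv : ∀ q, T.MemMh q → ∫ x in Ω, inner ℝ (gradient q x) (u x) = 0) {s : E d → ℝ}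
    (hs : T.MemP1 s) : ∑ k, T.residual u k s = 0 := by
  classical
  have h1 := T.setIntegral_inner_gradient_eq_zero hb hdiv hs
  rw [T.setIntegral_eq_sum hΩ hL (T.integrableOn_inner_gradient hu hs)] at h1
  -- The vector flux `V e` depends on the face only as a set, so the elements sharing it differ just
  -- by their normals. On boundary faces the `phi` term cancels the boundary term of Green's
  -- formula, hence the value 0 in `G`.
  set V : Set (E d) → E d := fun e => ∫ x, s x • u x ∂surf e with hV
  set G : Set (E d) → E d → ℝ := fun e n => if e ⊆ frontier Ω then 0 else inner ℝ (V e) n with hG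
  have hcs : ∀ k j, ContinuousOn (fun x => s x • u x) (face (T.elem k) j) := fun k j =>
    (hs.1.smul hu.1).mono ((face_subset_cell _ j).trans (T.cell_subset_closure k))
  have h2 : ∀ k, T.residual u k s
      = ∑ j, G (face (T.elem k) j) (normal (T.elem k) j)
        - ∫ x in cell (T.elem k), inner ℝ (gradient s x) (u x) := by
    intro k
    rw [residual, T.setIntegral_mul_div_eq hu hs, sub_right_comm, ← Finset.sum_sub_distrib]
    congr 1
    refine Finset.sum_congr rfl fun j _ => ?_
    have e1 : ∫ x, T.phi u k j x * s x ∂surf (face (T.elem k) j)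
        = if face (T.elem k) j ⊆ frontier Ω then
          ∫ x, s x * inner ℝ (u x) (normal (T.elem k) j) ∂surf (face (T.elem k) j) else 0 := by
      by_cases h : face (T.elem k) j ⊆ frontier Ω
      · rw [if_pos h]
        refine integral_congr_ae ?_
        filter_upwards [ae_surf_mem (T.elem k) j] with x hx
        rw [T.phi_eq hΩ hL hu.1 hx, if_pos h, mul_comm]
      · rw [if_neg h]
        refine integral_eq_zero_of_ae ?_
        filter_upwards [ae_surf_mem (T.elem k) j] with x hx
        rw [T.phi_eq hΩ hL hu.1 hx, if_neg h, zero_mul]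
        rfl
    rw [e1]
    by_cases h : face (T.elem k) j ⊆ frontier Ω
    · simp only [hG, if_pos h, sub_self]
    · simp only [hG, if_neg h, sub_zero, hV]
      rw [real_inner_comm, ← integral_inner (integrable_surf _ j (hcs k j))]
      refine integral_congr_ae (ae_of_all _ fun x => ?_)
      simp only [inner_smul_right, real_inner_comm]
  simp only [h2, Finset.sum_sub_distrib, h1, sub_zero]
  -- Pairs (element, local face) are grouped by the underlying set, so that the normals cancel
  -- inside each group.
  rw [← Finset.sum_product', ← Finset.sum_fiberwise_of_maps_to
    (s := Finset.univ ×ˢ Finset.univ) (t := (Finset.univ ×ˢ Finset.univ).image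
      fun p : Fin T.N × Fin (d + 1) => face (T.elem p.1) p.2)
    (g := fun p : Fin T.N × Fin (d + 1) => face (T.elem p.1) p.2)
    (fun p hp => Finset.mem_image_of_mem _ hp)]
  refine Finset.sum_eq_zero fun e he => ?_
  obtain ⟨⟨k, j⟩, -, rfl⟩ := Finset.mem_image.1 he
  rw [Finset.sum_filter, Finset.sum_product]
  by_cases h : face (T.elem k) j ⊆ frontier Ω
  · refine Finset.sum_eq_zero fun k' _ => Finset.sum_eq_zero fun j' _ => ?_
    by_cases he : face (T.elem k') j' = face (T.elem k) j
    · simp only [hG, he, if_pos h, if_true]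
    · simp only [he, if_false]
  · refine Eq.trans ?_ (T.sum_inner_normal_eq_zero hΩ hL h (V (face (T.elem k) j)))
    refine Finset.sum_congr rfl fun k' _ => Finset.sum_congr rfl fun j' _ => ?_
    by_cases he : face (T.elem k') j' = face (T.elem k) j
    · simp only [hG, he, if_neg h, if_true]
    · simp only [he, if_false]

/-! ### Test functions in `M` supported, up to a constant, in one element. -/

theorem restrict_vol_cell (hΩ : IsOpen Ω) (hL : HasLipschitzBoundary Ω) (k : Fin T.N) :
    (vol Ω).restrict (cell (T.elem k)) = vol (cell (T.elem k)) := by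
  rw [vol, Measure.restrict_restrict (measurableSet_cell _)]
  refine Measure.restrict_congr_set ?_
  refine ae_eq_set.2 ⟨by simp [sdiff_eq_empty.2 inter_subset_left],
    measure_mono_null ?_ (volume_frontier_cell (T.elem k))⟩
  rintro x ⟨hx, hxΩ⟩
  exact ⟨subset_closure hx, fun h => hxΩ ⟨hx, T.interior_cell_subset hΩ hL k h⟩⟩

theorem setIntegral_indicator_cell (hΩ : IsOpen Ω) (hL : HasLipschitzBoundary Ω) (k : Fin T.N)
    {F : Type*} [NormedAddCommGroup F] [NormedSpace ℝ F] (f : E d → F) :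
    ∫ x in Ω, (cell (T.elem k)).indicator f x = ∫ x in cell (T.elem k), f x := by
  rw [integral_indicator (measurableSet_cell _)]
  exact congrArg (fun μ => ∫ x, f x ∂μ) (T.restrict_vol_cell hΩ hL k)

theorem memLp_indicator_cell (hb : Bornology.IsBounded Ω) (k : Fin T.N) {F : Type*}
    [NormedAddCommGroup F] {f : E d → F} (hf : ContinuousOn f (cell (T.elem k))) (p : ℝ≥0∞) :
    MemLp ((cell (T.elem k)).indicator f) p (vol Ω) := by
  have hfin : IsFiniteMeasure (vol Ω) := ⟨by rw [Measure.restrict_apply_univ]; exact hb.measure_lt_top⟩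
  obtain ⟨C, hC⟩ := (isCompact_cell (T.elem k)).exists_bound_of_continuousOn hf
  have hm : AEStronglyMeasurable ((cell (T.elem k)).indicator f) volume :=
    (aestronglyMeasurable_indicator_iff (measurableSet_cell _)).2
      (hf.aestronglyMeasurable_of_isCompact (isCompact_cell _) (measurableSet_cell _))
  refine MemLp.of_bound hm.restrict (max C 0) (ae_of_all _ fun x => ?_)
  by_cases hx : x ∈ cell (T.elem k)
  · rw [indicator_of_mem hx]; exact (hC x hx).trans (le_max_left _ _)
  · rw [indicator_of_notMem hx, norm_zero]; exact le_max_right _ _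

theorem hasWeakGradient_indicator [NeZero d] (hΩ : IsOpen Ω) (hb : Bornology.IsBounded Ω)
    (hL : HasLipschitzBoundary Ω) (k : Fin T.N) {Q : E d → ℝ} (hQ : ContDiff ℝ ∞ Q)
    (h0 : ∀ j, ∀ x ∈ face (T.elem k) j, x ∈ frontier Ω ∨ Q x = 0) (c : ℝ) :
    HasWeakGradient Ω (fun x => (cell (T.elem k)).indicator Q x - c)
      ((cell (T.elem k)).indicator (gradient Q)) := by
  intro φ hφ
  have hφ1 : ContDiff ℝ 1 φ := hφ.1.of_le (by simp)
  have hQ1 : ContDiff ℝ 1 Q := hQ.of_le (by simp)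
  have hgφ := continuous_gradient hφ1
  have hgQ := continuous_gradient hQ1
  have hφc := hφ1.continuous
  have hQc := hQ1.continuous
  have hcpt := isCompact_cell (T.elem k)
  have hgint : IntegrableOn (gradient φ) Ω :=
    integrableOn_of_continuousOn_closure hb hgφ.continuousOn
  have e1 : ∀ x, ((cell (T.elem k)).indicator Q x - c) • gradient φ x
      = (cell (T.elem k)).indicator (fun x => Q x • gradient φ x) x - c • gradient φ x := by
    intro x
    rw [sub_smul, indicator_smul_left]
  have e2 : ∀ x, φ x • (cell (T.elem k)).indicator (gradient Q) x
      = (cell (T.elem k)).indicator (fun x => φ x • gradient Q x) x := by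
    intro x
    rw [indicator_smul_apply]
  simp only [e1, e2]
  have hi1 : IntegrableOn (fun x => Q x • gradient φ x) (cell (T.elem k)) :=
    (by fun_prop : Continuous _).continuousOn.integrableOn_compact hcpt
  have hi2 : IntegrableOn (fun x => φ x • gradient Q x) (cell (T.elem k)) :=
    (by fun_prop : Continuous _).continuousOn.integrableOn_compact hcpt
  rw [integral_sub (g := fun x => c • gradient φ x)
      ((integrable_indicator_iff (measurableSet_cell _)).2
      (by rw [IntegrableOn, T.restrict_vol_cell hΩ hL]; exact hi1)) (hgint.smul c),
    integral_smul, T.setIntegral_indicator_cell hΩ hL, T.setIntegral_indicator_cell hΩ hL]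
  have e3 : ∫ x in Ω, gradient φ x = 0 := by
    refine ext_inner_left ℝ fun v => ?_
    rw [← integral_inner hgint, inner_zero_right,
      ← setIntegral_fderiv_of_tsupport hφ1 hφ.2.1 hφ.2.2 v]
    simp only [fderiv_apply_eq_inner_gradient, real_inner_comm]
  rw [e3, smul_zero, sub_zero, eq_neg_iff_add_eq_zero, ← integral_add hi1 hi2]
  -- It remains to integrate the derivative of `Q φ` over the cell. On each face this product
  -- vanishes, through `Q` or, on the boundary of `Ω`, through the compactly supported `φ`.
  refine ext_inner_left ℝ fun v => ?_
  rw [← integral_inner (f := fun x => Q x • gradient φ x + φ x • gradient Q x) (hi1.add hi2),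
    inner_zero_right,
    ← setIntegral_fderiv_eq_zero (T.elem k) (hQ1.mul hφ1) ?_ v]
  · refine setIntegral_congr_fun (measurableSet_cell _) fun x _ => ?_
    have h1 : DifferentiableAt ℝ Q x := (hQ1.differentiable one_ne_zero).differentiableAt
    have h2 : DifferentiableAt ℝ φ x := (hφ1.differentiable one_ne_zero).differentiableAt
    rw [fderiv_fun_mul h1 h2]
    simp only [add_apply, smul_apply,
      fderiv_apply_eq_inner_gradient, inner_add_right, inner_smul_right, smul_eq_mul]
    simp only [real_inner_comm]
  · intro j x hx
    rcases h0 j x hx with h | h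
    · rw [hΩ.frontier_eq] at h
      rw [image_eq_zero_of_notMem_tsupport (fun h' => h.2 (hφ.2.2 h')), mul_zero]
    · rw [h, zero_mul]

theorem memM_indicator [NeZero d] (hΩ : IsOpen Ω) (hb : Bornology.IsBounded Ω)
    (hL : HasLipschitzBoundary Ω) (k : Fin T.N) {Q : E d → ℝ} (hQ : ContDiff ℝ ∞ Q)
    (h0 : ∀ j, ∀ x ∈ face (T.elem k) j, x ∈ frontier Ω ∨ Q x = 0) :
    ∃ c : ℝ, MemM Ω (fun x => (cell (T.elem k)).indicator Q x - c)
      ((cell (T.elem k)).indicator (gradient Q)) := by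
  have hfin : volume Ω ≠ ⊤ := hb.measure_lt_top.ne
  have hfm : IsFiniteMeasure (vol Ω) := ⟨by rw [Measure.restrict_apply_univ]; exact hb.measure_lt_top⟩
  have hne : volume Ω ≠ 0 := by
    refine ((isOpen_interior.measure_pos volume (nonempty_interior_cell (T.elem k))).trans_le
      (measure_mono (T.interior_cell_subset hΩ hL k))).ne'
  have hr : volume.real Ω ≠ 0 := (measureReal_ne_zero_iff hfin).2 hne
  have hm := fun p => T.memLp_indicator_cell hb k hQ.continuous.continuousOn p
  refine ⟨(volume.real Ω)⁻¹ * ∫ x in Ω, (cell (T.elem k)).indicator Q x, ?_, ?_, ?_, ?_, ?_⟩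
  · exact (hm _).sub (memLp_const _)
  · exact T.memLp_indicator_cell hb k (continuous_gradient (hQ.of_le (by simp))).continuousOn _
  · exact T.hasWeakGradient_indicator hΩ hb hL k hQ h0 _
  · exact (hm _).sub (memLp_const _)
  · rw [integral_sub (memLp_one_iff_integrable.1 (hm 1)) (integrable_const _), setIntegral_const]
    simp only [smul_eq_mul]
    field_simp
    ring

/-- The constant sequence `P` serves as the smooth approximation. -/
theorem isTrace_of_eq [NeZero d] (k : Fin T.N) (j : Fin (d + 1)) {q : E d → ℝ} {G : E d → E d}
    {P : E d → ℝ} (hP : ContDiff ℝ ∞ P) (hq : ∀ᵐ x ∂vol (cell (T.elem k)), q x = P x)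
    (hG : ∀ᵐ x ∂vol (cell (T.elem k)), G x = gradient P x) : IsTrace (T.elem k) j q G P := by
  have hfm := isFiniteMeasure_surf_face (T.elem k) j
  obtain ⟨C, hC⟩ := (isCompact_face (T.elem k) j).exists_bound_of_continuousOn
    hP.continuous.continuousOn
  refine ⟨MemLp.of_bound hP.continuous.aestronglyMeasurable C
    ((ae_surf_mem _ j).mono hC), fun _ => P, fun _ => hP, ?_, ?_, ?_⟩
  · have : P - q =ᵐ[vol (cell (T.elem k))] 0 := by
      filter_upwards [hq] with x hx
      simp [hx]
    simp [eLpNorm_congr_ae this]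
  · have : gradient P - G =ᵐ[vol (cell (T.elem k))] 0 := by
      filter_upwards [hG] with x hx
      simp [hx]
    simp [eLpNorm_congr_ae this]
  · simp

/-- The lifting of the pressure residual, tested with a smooth function localized in one element. -/
theorem IsLifting.setIntegral_inner_gradient [NeZero d] {T : Triangulation Ω} (hΩ : IsOpen Ω)
    (hb : Bornology.IsBounded Ω)
    (hL : HasLipschitzBoundary Ω) {u : E d → E d} (hu : T.MemXh u)
    (hdiv : ∀ q, T.MemMh q → ∫ x in Ω, inner ℝ (gradient q x) (u x) = 0)
    {rh : (E d → ℝ) → (E d → ℝ)} (hrh : ∀ q G, MemM Ω q G → T.MemP1 (rh q)) {vr : E d → E d}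
    (hvr : T.IsLifting rh u vr) (k : Fin T.N) {Q : E d → ℝ} (hQ : ContDiff ℝ ∞ Q)
    (h0 : ∀ j, ∀ x ∈ face (T.elem k) j, x ∈ frontier Ω ∨ Q x = 0) :
    ∫ x in cell (T.elem k), inner ℝ (gradient Q x) (vr x) = T.residual u k Q := by
  classical
  obtain ⟨c, hM⟩ := T.memM_indicator hΩ hb hL k hQ h0
  set q : E d → ℝ := fun x => (cell (T.elem k)).indicator Q x - c with hq
  have hr := hrh q _ hM
  -- `P k' - c` is the smooth representative of `q` on the element `k'`; it supplies the traces
  -- required by the lifting identity.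
  set P : Fin T.N → E d → ℝ := fun k' => if k' = k then Q else fun _ => 0 with hPdef
  have hP : ∀ k', ContDiff ℝ ∞ (P k') := by
    intro k'
    by_cases h : k' = k
    · simp only [hPdef, if_pos h]; exact hQ
    · simp only [hPdef, if_neg h]; exact contDiff_const
  have hPc : ∀ k', ContDiff ℝ ∞ (fun x => P k' x - c) := fun k' => (hP k').sub contDiff_const
  have hind : ∀ k', ∀ᵐ x ∂vol (cell (T.elem k')),
      (cell (T.elem k)).indicator Q x = P k' x ∧
        (cell (T.elem k)).indicator (gradient Q) x = gradient (fun x => P k' x - c) x := by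
    intro k'
    have hg : ∀ x, gradient (fun x => P k' x - c) x = gradient (P k') x := by
      intro x; rw [gradient, gradient, fderiv_sub_const]
    simp only [hg]
    by_cases h : k' = k
    · simp only [hPdef, if_pos h]
      filter_upwards [ae_restrict_mem (measurableSet_cell _)] with x hx
      rw [h] at hx
      rw [indicator_of_mem hx, indicator_of_mem hx]
      exact ⟨rfl, rfl⟩
    · have hnull : ∀ᵐ x ∂vol (cell (T.elem k')), x ∉ cell (T.elem k) := by
        rw [vol, ae_restrict_iff' (measurableSet_cell _)]
        have := measure_eq_zero_iff_ae_notMem.1 (T.aedisjoint_cell h)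
        filter_upwards [this] with x hx hx1 hx2
        exact hx ⟨hx1, hx2⟩
      filter_upwards [hnull] with x hx
      rw [indicator_of_notMem hx, indicator_of_notMem hx]
      simp only [hPdef, if_neg h]
      refine ⟨trivial, ?_⟩
      simp [gradient]
  have key := hvr.2 q _ hM (fun k' _ x => P k' x - c) fun k' j =>
    T.isTrace_of_eq k' j (hPc k') ((hind k').mono fun x hx => by rw [hq]; simp only [hx.1])
      ((hind k').mono fun x hx => hx.2)
  have eL : ∫ x in Ω, inner ℝ ((cell (T.elem k)).indicator (gradient Q) x) (vr x)
      = ∫ x in cell (T.elem k), inner ℝ (gradient Q x) (vr x) := by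
    rw [← T.setIntegral_indicator_cell hΩ hL]
    congr 1
    funext x
    by_cases hx : x ∈ cell (T.elem k)
    · rw [indicator_of_mem hx, indicator_of_mem hx]
    · rw [indicator_of_notMem hx, indicator_of_notMem hx, inner_zero_left]
  -- The interpolant and the mean value are absorbed into one continuous piecewise affine function,
  -- on which the total residual vanishes.
  set r : E d → ℝ := fun x => rh q x - (-c) with hrdef
  have hrP : T.MemP1 r := hr.sub_const (-c)
  have eR : ∀ k', (∫ x in cell (T.elem k'), (q x - rh q x) * div u x)
      - ∑ j, ∫ x, T.phi u k' j x * ((P k' x - c) - rh q x) ∂surf (face (T.elem k') j)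
      = T.residual u k' (P k') - T.residual u k' r := by
    intro k'
    rw [← T.residual_sub hΩ hL hu (hP k').continuous.continuousOn
      (hrP.1.mono (T.cell_subset_closure k')), residual]
    congr 1
    · refine integral_congr_ae ?_
      filter_upwards [hind k'] with x hx
      simp only [hq, hrdef, hx.1]
      ring
    · refine Finset.sum_congr rfl fun j _ => integral_congr_ae (ae_of_all _ fun x => ?_)
      simp only [hrdef]
      ring
  rw [eL] at key
  rw [key]
  simp only [eR, Finset.sum_sub_distrib, T.sum_residual_eq_zero hΩ hb hL hu hdiv hrP, sub_zero]
  rw [Finset.sum_eq_single k]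
  · simp only [hPdef, if_true]
  · intro k' _ h
    simp only [hPdef, if_neg h]
    simp [residual]
  · intro h; exact absurd (Finset.mem_univ k) h

end Triangulation

/-! ### Scaling estimates -/

section Scaling

variable {d : ℕ} (κ : AffineBasis (Fin (d + 1)) ℝ (E d))

/-- The barycentric coordinates of a point. -/
def bary (x : E d) : Fin (d + 1) → ℝ := fun i => κ.coord i x

theorem contDiff_bary {n : WithTop ℕ∞} : ContDiff ℝ n (bary κ) :=
  contDiff_pi.2 fun i => contDiff_coord κ i

theorem continuous_bary : Continuous (bary κ) := (contDiff_bary κ (n := 0)).continuous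

theorem bary_mem_stdSimplex {x : E d} (hx : x ∈ cell κ) : bary κ x ∈ stdSimplex ℝ (Fin (d + 1)) :=
  ⟨fun i => (mem_cell κ).1 hx i, κ.sum_coord_apply_eq_one x⟩

theorem exists_bary_eq {s : Fin (d + 1) → ℝ} (hs : s ∈ stdSimplex ℝ (Fin (d + 1))) :
    ∃ x ∈ cell κ, bary κ x = s := by
  have h : bary κ (Finset.univ.affineCombination ℝ κ s) = s := by
    funext i
    exact κ.coord_apply_combination_of_mem (Finset.mem_univ i) hs.2
  refine ⟨_, (mem_cell κ).2 fun i => ?_, h⟩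
  rw [show κ.coord i _ = s i from congrFun h i]
  exact hs.1 i

/-- Integrals of functions of the barycentric coordinates scale with the volume. -/
theorem setIntegral_bary_mul (κ₀ : AffineBasis (Fin (d + 1)) ℝ (E d)) (G : (Fin (d + 1) → ℝ) → ℝ)
    (hG : Continuous G) :
    (∫ x in cell κ, G (bary κ x)) * volume.real (cell κ₀)
      = volume.real (cell κ) * ∫ x in cell κ₀, G (bary κ₀ x) := by
  let L : E d ≃ₗ[ℝ] E d := (κ₀.basisOf 0).equiv (κ.basisOf 0) (Equiv.refl _)
  have hL : ∀ i, L (κ₀ i - κ₀ 0) = κ i - κ 0 := by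
    intro i
    by_cases hi : i = 0
    · simp [hi]
    · have h1 := (κ₀.basisOf 0).equiv_apply (⟨i, hi⟩ : {j // j ≠ (0 : Fin (d + 1))}) (κ.basisOf 0) (Equiv.refl _)
      simpa using h1
  have hLc : Continuous L := L.toLinearMap.continuous_of_finiteDimensional
  -- `Ψ` is the affine map from `κ₀` onto `κ` that preserves barycentric coordinates.
  set Ψ : E d → E d := fun x => L (x - κ₀ 0) + κ 0 with hΨ
  have hΨb : ∀ x, bary κ (Ψ x) = bary κ₀ x := by
    intro x
    funext j
    have h1 := eq_sum_edges κ₀ (x - κ₀ 0)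
    have h2 : L (x - κ₀ 0) = ∑ i, inner ℝ (coordGrad κ₀ i) (x - κ₀ 0) • (κ i - κ 0) := by
      conv_lhs => rw [h1]
      simp only [map_sum, map_smul, hL]
    have h3 := coord_add κ₀ j (κ₀ 0) (x - κ₀ 0)
    rw [add_sub_cancel, κ₀.coord_apply] at h3
    have h4 := coord_add κ j (κ 0) (L (x - κ₀ 0))
    rw [h2, inner_sum, κ.coord_apply] at h4
    simp only [inner_smul_right, inner_coordGrad_sub, mul_sub, Finset.sum_sub_distrib,
      ← Finset.sum_mul, sum_inner_coordGrad] at h4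
    simp only [bary, hΨ]
    rw [add_comm (L _) (κ 0), h2, h4, h3]
    simp
  have hdet : LinearMap.det (L : E d →ₗ[ℝ] E d) ≠ 0 := (LinearEquiv.isUnit_det' L).ne_zero
  have hmap : Measure.map Ψ volume
      = ENNReal.ofReal |(LinearMap.det (L : E d →ₗ[ℝ] E d))⁻¹| • volume := by
    have h1 := Measure.map_linearMap_addHaar_eq_smul_addHaar (volume : Measure (E d)) hdet
    have h2 : Ψ = (fun y => y + κ 0) ∘ L ∘ (fun x => x + -κ₀ 0) := by
      funext x; simp [hΨ, sub_eq_add_neg]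
    rw [h2, ← Measure.map_map (by fun_prop) (by fun_prop), ← Measure.map_map (by fun_prop)
      (by fun_prop), map_add_right_eq_self, map_add_right_eq_self]
    exact h1
  have hΨc : Continuous Ψ := by fun_prop
  have key : ∀ H : (Fin (d + 1) → ℝ) → ℝ, Continuous H →
      |(LinearMap.det (L : E d →ₗ[ℝ] E d))⁻¹| * ∫ x in cell κ, H (bary κ x)
        = ∫ x in cell κ₀, H (bary κ₀ x) := by
    intro H hH
    have hHm : Measurable fun x => H (bary κ x) := (hH.comp (continuous_bary κ)).measurable
    have h1 : ∫ x, (cell κ).indicator (fun x => H (bary κ x)) x ∂(Measure.map Ψ volume)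
        = |(LinearMap.det (L : E d →ₗ[ℝ] E d))⁻¹| * ∫ x in cell κ, H (bary κ x) := by
      rw [hmap, integral_smul_measure, integral_indicator (measurableSet_cell κ),
        ENNReal.toReal_ofReal (abs_nonneg _), smul_eq_mul]
    rw [← h1, integral_map hΨc.measurable.aemeasurable
      (hHm.indicator (measurableSet_cell κ)).aestronglyMeasurable,
      ← integral_indicator (measurableSet_cell κ₀)]
    congr 1
    funext x
    have hiff : Ψ x ∈ cell κ ↔ x ∈ cell κ₀ := by
      simp only [mem_cell]
      exact forall_congr' fun i => by rw [show κ.coord i (Ψ x) = κ₀.coord i x from congrFun (hΨb x) i]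
    by_cases hx : x ∈ cell κ₀
    · rw [indicator_of_mem hx, indicator_of_mem (hiff.2 hx), hΨb]
    · rw [indicator_of_notMem hx, indicator_of_notMem (fun h => hx (hiff.1 h))]
  -- The constant function identifies the Jacobian with the ratio of the volumes.
  have k1 := key (fun _ => 1) continuous_const
  simp only [setIntegral_const, smul_eq_mul, mul_one] at k1
  rw [← k1, ← key G hG]
  ring

/-- Uniform coercivity of weighted `L²` forms on finite-dimensional spaces of functions of the
barycentric coordinates. -/
theorem exists_lower_bound {ι : Type*} [Fintype ι] [Nonempty ι] {W : (Fin (d + 1) → ℝ) → ℝ}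
    {p : ι → (Fin (d + 1) → ℝ) → ℝ} (hW : Continuous W) (hW0 : ∀ s, (∀ i, 0 ≤ s i) → 0 ≤ W s)
    (hWpos : ∀ s, (∀ i, 0 < s i) → 0 < W s) (hp : ∀ a, Continuous (p a))
    (hinj : ∀ θ : ι → ℝ, (∀ s ∈ stdSimplex ℝ (Fin (d + 1)), ∑ a, θ a * p a s = 0) → θ = 0) :
    ∃ c : ℝ, 0 < c ∧ ∀ (κ : AffineBasis (Fin (d + 1)) ℝ (E d)) (θ : ι → ℝ),
      c * volume.real (cell κ) * ‖θ‖ ^ 2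
        ≤ ∫ x in cell κ, W (bary κ x) * (∑ a, θ a * p a (bary κ x)) ^ 2 := by
  obtain ⟨κ₀⟩ : Nonempty (AffineBasis (Fin (d + 1)) ℝ (E d)) :=
    AffineBasis.exists_affineBasis_of_finiteDimensional (by simp)
  have hb := continuous_bary κ₀
  have hv0 : 0 < volume.real (cell κ₀) :=
    ENNReal.toReal_pos (volume_cell_pos κ₀).ne' (volume_cell_lt_top κ₀).ne
  set I : (ι → ℝ) → ℝ := fun θ =>
    ∫ x in cell κ₀, W (bary κ₀ x) * (∑ a, θ a * p a (bary κ₀ x)) ^ 2 with hI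
  have hIc : Continuous I :=
    continuous_parametric_integral_of_continuous
      (f := fun (θ : ι → ℝ) (x : E d) => W (bary κ₀ x) * (∑ a, θ a * p a (bary κ₀ x)) ^ 2)
      (by fun_prop) (isCompact_cell κ₀)
  have hIpos : ∀ θ, θ ≠ 0 → 0 < I θ := by
    intro θ hθ
    have : ∃ s ∈ stdSimplex ℝ (Fin (d + 1)), ∑ a, θ a * p a s ≠ 0 := by
      by_contra h
      push Not at h
      exact hθ (hinj θ h)
    obtain ⟨s, hs, hne⟩ := this
    obtain ⟨x, hx, rfl⟩ := exists_bary_eq κ₀ hs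
    have ho : IsOpen {x | ∑ a, θ a * p a (bary κ₀ x) ≠ 0} :=
      isOpen_ne_fun (by fun_prop) continuous_const
    obtain ⟨y, hy, hyi⟩ := mem_closure_iff.1 (cell_subset_closure_interior κ₀ hx) _ ho hne
    have hyi' := hyi
    rw [interior_cell] at hyi'
    refine setIntegral_cell_pos κ₀ (by fun_prop) (fun z hz => ?_) (interior_subset hyi) ?_
    · exact mul_nonneg (hW0 _ ((mem_cell κ₀).1 hz)) (sq_nonneg _)
    · have hy : ∑ a, θ a * p a (bary κ₀ y) ≠ 0 := hy
      exact mul_pos (hWpos _ hyi') (by positivity)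
  -- On the reference simplex the quadratic form `I` is continuous and positive off zero, so its
  -- minimum on the unit sphere is positive; homogeneity gives the bound for all `θ`.
  obtain ⟨θ₀, hθ₀, hmin⟩ := (isCompact_sphere (0 : ι → ℝ) 1).exists_isMinOn
    (NormedSpace.sphere_nonempty.2 zero_le_one) hIc.continuousOn
  have hθ₀' : θ₀ ≠ 0 := ne_zero_of_mem_unit_sphere ⟨θ₀, hθ₀⟩
  have hm : ∀ θ, I θ₀ * ‖θ‖ ^ 2 ≤ I θ := by
    intro θ
    by_cases hθ : θ = 0
    · subst hθ
      simp [hI]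
    have hn : 0 < ‖θ‖ := norm_pos_iff.2 hθ
    have h1 : I θ₀ ≤ I (‖θ‖⁻¹ • θ) := hmin (by simp [norm_smul, hn.ne'])
    have h2 : I (‖θ‖⁻¹ • θ) = (‖θ‖⁻¹) ^ 2 * I θ := by
      simp only [hI]
      rw [← integral_const_mul]
      congr 1
      funext x
      simp only [Pi.smul_apply, smul_eq_mul, mul_assoc, ← Finset.mul_sum]
      ring
    rw [h2] at h1
    calc I θ₀ * ‖θ‖ ^ 2 ≤ (‖θ‖⁻¹ ^ 2 * I θ) * ‖θ‖ ^ 2 := by gcongr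
      _ = I θ := by field_simp
  refine ⟨I θ₀ / volume.real (cell κ₀), div_pos (hIpos θ₀ hθ₀') hv0, fun κ θ => ?_⟩
  have h1 := setIntegral_bary_mul κ κ₀ (fun s => W s * (∑ a, θ a * p a s) ^ 2) (by fun_prop)
  have h2 : ∫ x in cell κ, W (bary κ x) * (∑ a, θ a * p a (bary κ x)) ^ 2
      = volume.real (cell κ) * I θ / volume.real (cell κ₀) := by
    rw [eq_div_iff hv0.ne']; exact h1
  rw [h2, div_mul_eq_mul_div, div_mul_eq_mul_div, mul_assoc, mul_left_comm]
  gcongr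
  exact hm θ

/-- Uniform bounds for functions of the barycentric coordinates and for their gradients. -/
theorem exists_upper_bound {ι : Type*} [Fintype ι] {p : ι → (Fin (d + 1) → ℝ) → ℝ}
    (hp : ∀ a, ContDiff ℝ 1 (p a)) :
    ∃ C : ℝ, 0 < C ∧ ∀ (κ : AffineBasis (Fin (d + 1)) ℝ (E d)) (θ : ι → ℝ), ∀ x ∈ cell κ,
      |∑ a, θ a * p a (bary κ x)| ≤ C * ‖θ‖ ∧
      ∀ Γ, (∀ i, ‖coordGrad κ i‖ ≤ Γ) →
        ‖gradient (fun x => ∑ a, θ a * p a (bary κ x)) x‖ ≤ C * ‖θ‖ * Γ := by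
  have hK : IsCompact (stdSimplex ℝ (Fin (d + 1))) := isCompact_stdSimplex ℝ _
  have h1 : ∀ a, ∃ C, ∀ s ∈ stdSimplex ℝ (Fin (d + 1)), ‖p a s‖ ≤ C := fun a =>
    hK.exists_bound_of_continuousOn (hp a).continuous.continuousOn
  have h2 : ∀ a, ∃ C, ∀ s ∈ stdSimplex ℝ (Fin (d + 1)), ‖fderiv ℝ (p a) s‖ ≤ C := fun a =>
    hK.exists_bound_of_continuousOn ((hp a).continuous_fderiv one_ne_zero).continuousOn
  choose C₁ hC₁ using h1
  choose C₂ hC₂ using h2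
  refine ⟨∑ a, (|C₁ a| + |C₂ a|) + 1, by positivity, fun κ θ x hx => ?_⟩
  have hs := bary_mem_stdSimplex κ hx
  refine ⟨?_, fun Γ hΓ => ?_⟩
  · calc |∑ a, θ a * p a (bary κ x)| ≤ ∑ a, |θ a * p a (bary κ x)| := Finset.abs_sum_le_sum_abs _ _
      _ ≤ ∑ a, ‖θ‖ * (|C₁ a| + |C₂ a|) := by
        refine Finset.sum_le_sum fun a _ => ?_
        rw [abs_mul]
        have e1 : |θ a| ≤ ‖θ‖ := norm_le_pi_norm θ a
        have e2 : |p a (bary κ x)| ≤ |C₁ a| + |C₂ a| :=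
          (hC₁ a _ hs).trans ((le_abs_self _).trans (le_add_of_nonneg_right (abs_nonneg _)))
        gcongr
      _ ≤ (∑ a, (|C₁ a| + |C₂ a|) + 1) * ‖θ‖ := by
        rw [← Finset.mul_sum, mul_comm]
        have := norm_nonneg θ
        nlinarith
  · have hΓ0 : 0 ≤ Γ := (norm_nonneg _).trans (hΓ 0)
    -- The derivative of `bary`. With the sup norm on the coordinates its operator norm is at most
    -- the largest `‖∇λ_i‖`.
    let Λ : E d →L[ℝ] (Fin (d + 1) → ℝ) := ContinuousLinearMap.pi fun i =>
      (κ.coord i).linear.toContinuousLinearMap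
    have hΛ : ‖Λ‖ ≤ Γ := by
      refine ContinuousLinearMap.opNorm_le_bound _ hΓ0 fun v => ?_
      refine (pi_norm_le_iff_of_nonneg (by positivity)).2 fun i => ?_
      have : Λ v i = inner ℝ (coordGrad κ i) v := linear_coord_apply κ i v
      rw [this]
      exact (norm_inner_le_norm _ _).trans (by gcongr; exact hΓ i)
    have hΛd : HasFDerivAt (bary κ) Λ x := hasFDerivAt_pi.2 fun i => hasFDerivAt_coord κ i x
    have hfd : HasFDerivAt (fun x => ∑ a, θ a * p a (bary κ x))
        (∑ a, θ a • (fderiv ℝ (p a) (bary κ x)).comp Λ) x := by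
      refine HasFDerivAt.fun_sum fun a _ => ?_
      have := (((hp a).differentiable one_ne_zero).differentiableAt.hasFDerivAt
        (x := bary κ x)).comp x hΛd
      exact this.const_mul (θ a)
    rw [gradient, LinearIsometryEquiv.norm_map, hfd.fderiv]
    calc ‖∑ a, θ a • (fderiv ℝ (p a) (bary κ x)).comp Λ‖
        ≤ ∑ a, ‖θ‖ * (|C₁ a| + |C₂ a|) * Γ := by
          refine norm_sum_le_of_le _ fun a _ => ?_
          rw [norm_smul, mul_assoc]
          have e1 : ‖θ a‖ ≤ ‖θ‖ := norm_le_pi_norm θ a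
          have e2 : ‖fderiv ℝ (p a) (bary κ x)‖ ≤ |C₁ a| + |C₂ a| :=
            (hC₂ a _ hs).trans ((le_abs_self _).trans (le_add_of_nonneg_left (abs_nonneg _)))
          have e3 := (fderiv ℝ (p a) (bary κ x)).opNorm_comp_le Λ
          have e4 : ‖fderiv ℝ (p a) (bary κ x)‖ * ‖Λ‖ ≤ (|C₁ a| + |C₂ a|) * Γ := by gcongr
          exact mul_le_mul e1 (e3.trans e4) (norm_nonneg _) (norm_nonneg _)
      _ ≤ (∑ a, (|C₁ a| + |C₂ a|) + 1) * ‖θ‖ * Γ := by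
        rw [← Finset.sum_mul, ← Finset.mul_sum]
        refine mul_le_mul_of_nonneg_right ?_ hΓ0
        rw [mul_comm]
        have := norm_nonneg θ
        nlinarith

/-! ### Shape regularity -/

theorem diam_cell_pos [NeZero d] : 0 < Metric.diam (cell κ) := by
  have : Nontrivial (Fin (d + 1)) := Fin.nontrivial_iff_two_le.2 (by have := NeZero.pos d; omega)
  obtain ⟨i, l, hil⟩ := exists_pair_ne (Fin (d + 1))
  refine (dist_pos.2 (κ.ind.injective.ne hil)).trans_le ?_
  exact Metric.dist_le_diam_of_mem (isCompact_cell κ).isBounded (vertex_mem_cell κ i)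
    (vertex_mem_cell κ l)

/-- Along an edge ending at vertex `i`, of length at most the diameter, `λ_i` climbs from 0 to 1. -/
theorem one_le_norm_coordGrad_mul_diam [NeZero d] (i : Fin (d + 1)) :
    1 ≤ ‖coordGrad κ i‖ * Metric.diam (cell κ) := by
  have : Nontrivial (Fin (d + 1)) := Fin.nontrivial_iff_two_le.2 (by have := NeZero.pos d; omega)
  obtain ⟨l, hl⟩ := exists_ne i
  have h1 : inner ℝ (coordGrad κ i) (κ i - κ l) = (1 : ℝ) := by
    rw [inner_coordGrad_sub]; simp [hl.symm]
  rw [← h1]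
  refine (real_inner_le_norm _ _).trans ?_
  gcongr
  rw [← dist_eq_norm]
  exact Metric.dist_le_diam_of_mem (isCompact_cell κ).isBounded (vertex_mem_cell κ i)
    (vertex_mem_cell κ l)

/-- Along the diameter of the ball parallel to `∇λ_i` the coordinate varies by `δ ‖∇λ_i‖` and must
stay in `[0, 1]`. -/
theorem mul_norm_coordGrad_le_one (i : Fin (d + 1)) {δ : ℝ} (hδ : 0 ≤ δ) {x : E d}
    (h : Metric.closedBall x (δ / 2) ⊆ cell κ) : δ * ‖coordGrad κ i‖ ≤ 1 := by
  by_cases hg : coordGrad κ i = 0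
  · simp [hg]
  have hn : 0 < ‖coordGrad κ i‖ := norm_pos_iff.2 hg
  set v := (δ / 2 * ‖coordGrad κ i‖⁻¹) • coordGrad κ i with hv
  have hvn : ‖v‖ = δ / 2 := by
    rw [hv, norm_smul, Real.norm_of_nonneg (by positivity)]
    field_simp
  have hvi : inner ℝ (coordGrad κ i) v = δ / 2 * ‖coordGrad κ i‖ := by
    rw [hv, inner_smul_right, real_inner_self_eq_norm_sq]
    field_simp
  have m1 : x + v ∈ cell κ := h (by simp [hvn])
  have m2 : x + -v ∈ cell κ := h (by simp [hvn])
  have h1 := coord_le_one κ m1 i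
  have h2 := (mem_cell κ).1 m2 i
  rw [coord_add, hvi] at h1
  rw [coord_add, inner_neg_right, hvi] at h2
  linarith

/-- The only place where shape regularity is exploited. The supremum defining `inDiam` must be shown
finite and positive, since otherwise its default value, or division by zero, would make the
hypothesis empty. -/
theorem norm_coordGrad_mul_diam_le [NeZero d] {σ : ℝ}
    (h : Metric.diam (cell κ) / inDiam κ ≤ σ) (i : Fin (d + 1)) :
    ‖coordGrad κ i‖ * Metric.diam (cell κ) ≤ σ := by
  have : Nontrivial (Fin (d + 1)) := Fin.nontrivial_iff_two_le.2 (by have := NeZero.pos d; omega)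
  obtain ⟨l, hl⟩ := exists_ne i
  have hn : 0 < ‖coordGrad κ i‖ := norm_pos_iff.2 (coordGrad_ne_zero κ hl.symm)
  have hub : ∀ δ ∈ {δ : ℝ | 0 ≤ δ ∧ ∃ x, Metric.closedBall x (δ / 2) ⊆ cell κ},
      δ ≤ ‖coordGrad κ i‖⁻¹ := by
    rintro δ ⟨hδ, x, hx⟩
    rw [← one_div, le_div_iff₀ hn]
    exact mul_norm_coordGrad_le_one κ i hδ hx
  have hle : inDiam κ ≤ ‖coordGrad κ i‖⁻¹ := Real.sSup_le hub (by positivity)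
  have hpos : 0 < inDiam κ := by
    obtain ⟨x, hx⟩ := nonempty_interior_cell κ
    obtain ⟨r, hr, hball⟩ := Metric.nhds_basis_closedBall.mem_iff.1
      (mem_interior_iff_mem_nhds.1 hx)
    refine (by positivity : (0 : ℝ) < 2 * r).trans_le (le_csSup ⟨_, hub⟩ ⟨by positivity, x, ?_⟩)
    rwa [mul_div_cancel_left₀ _ two_ne_zero]
  have hd := diam_cell_pos κ
  calc ‖coordGrad κ i‖ * Metric.diam (cell κ)
      ≤ (inDiam κ)⁻¹ * Metric.diam (cell κ) := by
        gcongr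
        rwa [le_inv_comm₀ hn hpos]
    _ = Metric.diam (cell κ) / inDiam κ := by rw [div_eq_inv_mul]
    _ ≤ σ := h

end Scaling

/-! ### Hölder-type inequalities in `L³`. -/

theorem lpNorm_three_le_of_bound {α F : Type*} [MeasurableSpace α] [NormedAddCommGroup F]
    {μ : Measure α} [IsFiniteMeasure μ] {f : α → F} {C : ℝ} (hC : 0 ≤ C)
    (h : ∀ᵐ x ∂μ, ‖f x‖ ≤ C) : lpNorm f 3 μ ≤ μ.real univ ^ (1 / 3 : ℝ) * C := by
  by_cases hf : AEStronglyMeasurable f μ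
  · rw [← toReal_eLpNorm hf]
    have h1 := eLpNorm_le_of_ae_bound (p := 3) h
    refine (ENNReal.toReal_mono (ENNReal.mul_ne_top ?_ ENNReal.ofReal_ne_top) h1).trans ?_
    · exact ENNReal.rpow_ne_top_of_nonneg (by positivity) (measure_ne_top _ _)
    · rw [ENNReal.toReal_mul, ← ENNReal.toReal_rpow, ENNReal.toReal_ofReal hC]
      simp [Measure.real]
  -- `lpNorm` is 0 by convention here, which spares a measurability proof for `phi`.
  · rw [lpNorm_of_not_aestronglyMeasurable hf]
    positivity

/-- Hölder against the constant 1. The exponent 2/3 is written as a square of a cube root so that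
later powers of the volume cancel as powers of a single number. -/
theorem integral_norm_le_lpNorm_three {α F : Type*} [MeasurableSpace α] [NormedAddCommGroup F]
    {μ : Measure α} [IsFiniteMeasure μ] {f : α → F} (hf : MemLp f 3 μ) :
    ∫ x, ‖f x‖ ∂μ ≤ (μ.real univ ^ (1 / 3 : ℝ)) ^ 2 * lpNorm f 3 μ := by
  rw [← lpNorm_one_eq_integral_norm hf.1, ← toReal_eLpNorm hf.1, ← toReal_eLpNorm hf.1]
  have h1 := eLpNorm_le_eLpNorm_mul_rpow_measure_univ (μ := μ) (p := 1) (q := 3) (by norm_num) hf.1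
  refine (ENNReal.toReal_mono (ENNReal.mul_ne_top hf.2.ne ?_) h1).trans ?_
  · exact ENNReal.rpow_ne_top_of_nonneg (by norm_num) (measure_ne_top _ _)
  · rw [ENNReal.toReal_mul, ← ENNReal.toReal_rpow, mul_comm, ← Real.rpow_natCast,
      ← Real.rpow_mul measureReal_nonneg]
    refine le_of_eq ?_
    norm_num [Measure.real]

/-! ### The finite-dimensional space containing the divergences of discrete velocities. -/

/-- The functions of the barycentric coordinates spanning the divergences of discrete velocities. -/
def divBasis {d : ℕ} : Option (Fin (d + 1)) → (Fin (d + 1) → ℝ) → ℝ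
  | none, _ => 1
  | some j, s => ∏ i ∈ Finset.univ.erase j, s i

theorem contDiff_divBasis {d : ℕ} {n : WithTop ℕ∞} (a : Option (Fin (d + 1))) :
    ContDiff ℝ n (divBasis a) := by
  cases a with
  | none => exact contDiff_const
  | some j => exact contDiff_prod fun i _ => contDiff_apply ℝ ℝ i

/-- Evaluation at a vertex isolates the constant, since each product has `d ≥ 2` factors and one
vanishes there; evaluation at the centre of face `j` then leaves only the `j`-th product. For `d =
1` the products would sum to the constant 1. -/
theorem divBasis_injective {d : ℕ} (hd : 2 ≤ d) (θ : Option (Fin (d + 1)) → ℝ)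
    (h : ∀ s ∈ stdSimplex ℝ (Fin (d + 1)), ∑ a, θ a * divBasis a s = 0) : θ = 0 := by
  have hnone : θ none = 0 := by
    have h1 := h _ (single_mem_stdSimplex ℝ (0 : Fin (d + 1)))
    rw [Fintype.sum_option, Finset.sum_eq_zero] at h1
    · simpa [divBasis] using h1
    · intro j _
      have : ∃ i ∈ Finset.univ.erase j, i ≠ (0 : Fin (d + 1)) := by
        by_cases hj : j = 1
        · refine ⟨⟨2, by omega⟩, ?_, ?_⟩
          · simp [hj, Fin.ext_iff]
            rw [Nat.mod_eq_of_lt (by omega)]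
            norm_num
          · simp [Fin.ext_iff]
        · refine ⟨1, by simp [Ne.symm hj], ?_⟩
          simp [Fin.ext_iff]
          omega
      obtain ⟨i, hi, hi0⟩ := this
      simp only [divBasis]
      rw [Finset.prod_eq_zero hi (by simp [hi0]), mul_zero]
  funext a
  cases a with
  | none => exact hnone
  | some j =>
    have hd0 : (0 : ℝ) < d := by exact_mod_cast (by omega : 0 < d)
    set s : Fin (d + 1) → ℝ := fun i => if i = j then 0 else (d : ℝ)⁻¹ with hs
    have hmem : s ∈ stdSimplex ℝ (Fin (d + 1)) := by
      refine ⟨fun i => ?_, ?_⟩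
      · simp only [hs]; split_ifs <;> positivity
      · rw [← Finset.add_sum_erase _ _ (Finset.mem_univ j)]
        have : ∀ i ∈ Finset.univ.erase j, s i = (d : ℝ)⁻¹ := fun i hi => by
          simp [hs, Finset.ne_of_mem_erase hi]
        rw [Finset.sum_congr rfl this]
        simp [hs, hd0.ne']
    have h1 := h s hmem
    rw [Fintype.sum_option, hnone, zero_mul, zero_add, Finset.sum_eq_single j] at h1
    · refine (mul_eq_zero.1 h1).resolve_right ?_
      simp only [divBasis]
      refine Finset.prod_ne_zero_iff.2 fun i hi => ?_
      simp [hs, Finset.ne_of_mem_erase hi, hd0.ne']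
    · intro i _ hij
      simp only [divBasis]
      rw [Finset.prod_eq_zero (i := j) (Finset.mem_erase.2 ⟨hij.symm, Finset.mem_univ j⟩)
        (by simp [hs]), mul_zero]
    · intro hj; exact absurd (Finset.mem_univ j) hj

section Simplex

variable {d : ℕ} (κ : AffineBasis (Fin (d + 1)) ℝ (E d))

theorem hasFDerivAt_bubble (x : E d) :
    HasFDerivAt (bubble κ)
      (∑ j, (∏ i ∈ Finset.univ.erase j, κ.coord i x) • (κ.coord j).linear.toContinuousLinearMap) x :=
  HasFDerivAt.finsetProd fun j _ => hasFDerivAt_coord κ j x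

/-- The affine part has constant divergence, and the gradient of the bubble is the sum over `j` of
`∏_{i ≠ j} λ_i` times `∇λ_j`. -/
theorem exists_div_eq (A : E d →ᵃ[ℝ] E d) (c : E d) :
    ∃ θ : Option (Fin (d + 1)) → ℝ, ∀ x,
      div (fun x => A x + bubble κ x • c) x = ∑ a, θ a * divBasis a (bary κ x) := by
  refine ⟨fun a => a.elim (∑ m, (A.linear (EuclideanSpace.single m 1)) m)
    (fun j => inner ℝ (coordGrad κ j) c), fun x => ?_⟩
  have hA : HasFDerivAt A A.linear.toContinuousLinearMap x := by
    have h : (A : E d → E d) = fun y => A.linear.toContinuousLinearMap y + A 0 := by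
      funext y
      simpa using congrFun A.decomp y
    rw [h]
    exact (A.linear.toContinuousLinearMap.hasFDerivAt).add_const _
  have hf := hA.fun_add ((hasFDerivAt_bubble κ x).smul_const c)
  rw [div, hf.fderiv, Fintype.sum_option]
  simp only [add_apply, PiLp.add_apply, Finset.sum_add_distrib]
  congr 1
  · simp [divBasis]
  · simp only [divBasis, Option.elim]
    have h1 : ∀ m : Fin d, (ContinuousLinearMap.smulRight (∑ j, (∏ i ∈ Finset.univ.erase j,
        κ.coord i x) • (κ.coord j).linear.toContinuousLinearMap) c (EuclideanSpace.single m 1)) m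
        = ∑ j, (∏ i ∈ Finset.univ.erase j, bary κ x i) * ((coordGrad κ j) m * c m) := by
      intro m
      simp only [ContinuousLinearMap.smulRight_apply, PiLp.smul_apply, smul_eq_mul,
        sum_apply, smul_apply, LinearMap.coe_toContinuousLinearMap',
        linear_coord_apply, Finset.sum_mul, bary]
      refine Finset.sum_congr rfl fun j _ => ?_
      rw [EuclideanSpace.inner_single_right]
      simp
      ring
    simp only [h1]
    rw [Finset.sum_comm]
    refine Finset.sum_congr rfl fun j _ => ?_
    rw [← Finset.mul_sum, PiLp.inner_apply, mul_comm]
    congr 1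
    refine Finset.sum_congr rfl fun m _ => ?_
    simp [mul_comm]

instance isFiniteMeasure_vol_cell : IsFiniteMeasure (vol (cell κ)) :=
  ⟨by rw [Measure.restrict_apply_univ]; exact volume_cell_lt_top κ⟩

/-- Hölder's inequality on a simplex for the pairing of a bounded and an `L³` function. -/
theorem abs_setIntegral_inner_le {F : Type*} [NormedAddCommGroup F] [InnerProductSpace ℝ F]
    {f g : E d → F} {B : ℝ} (hB : ∀ x ∈ cell κ, ‖f x‖ ≤ B) (hg : MemLp g 3 (vol (cell κ))) :
    |∫ x in cell κ, inner ℝ (f x) (g x)|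
      ≤ B * ((volume.real (cell κ) ^ (1 / 3 : ℝ)) ^ 2 * lpNorm g 3 (vol (cell κ))) := by
  have hB0 : 0 ≤ B := (norm_nonneg _).trans (hB _ (vertex_mem_cell κ 0))
  have h1 := integral_norm_le_lpNorm_three hg
  have hg1 : Integrable g (vol (cell κ)) := memLp_one_iff_integrable.1 (hg.mono_exponent (by norm_num))
  rw [measureReal_restrict_apply_univ] at h1
  calc |∫ x in cell κ, inner ℝ (f x) (g x)| ≤ ∫ x in cell κ, B * ‖g x‖ := by
        rw [← Real.norm_eq_abs]
        refine norm_integral_le_of_norm_le (hg1.norm.const_mul B) ?_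
        filter_upwards [ae_restrict_mem (measurableSet_cell κ)] with x hx
        exact (norm_inner_le_norm _ _).trans (by gcongr; exact hB x hx)
    _ = B * ∫ x in cell κ, ‖g x‖ := by rw [integral_const_mul]
    _ ≤ _ := by gcongr

end Simplex

/-! ### Local efficiency of the divergence and boundary terms. -/

namespace Triangulation

variable {d : ℕ}

/-- Local efficiency of the divergence part of the indicator. -/
theorem exists_div_estimate (hd : 2 ≤ d) (σ : ℝ) :
    ∃ C : ℝ, 0 ≤ C ∧ ∀ (Ω : Set (E d)) (T : Triangulation Ω) (u vr : E d → E d) (k : Fin T.N),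
      T.Regular σ → T.MemXh u → MemLp vr 3 (vol (cell (T.elem k))) →
      (∀ Q : E d → ℝ, ContDiff ℝ ∞ Q →
        (∀ j, ∀ x ∈ face (T.elem k) j, x ∈ frontier Ω ∨ Q x = 0) →
        ∫ x in cell (T.elem k), inner ℝ (gradient Q x) (vr x) = T.residual u k Q) →
      MemLp (div u) 3 (vol (cell (T.elem k))) ∧
      Metric.diam (cell (T.elem k)) * lpNorm (div u) 3 (vol (cell (T.elem k)))
        ≤ C * lpNorm vr 3 (vol (cell (T.elem k))) := by
  have : NeZero d := ⟨by omega⟩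
  obtain ⟨c, hc, hlow⟩ := exists_lower_bound (d := d) (ι := Option (Fin (d + 1)))
    (W := fun s => ∏ i, s i) (p := divBasis) (by fun_prop)
    (fun s hs => Finset.prod_nonneg fun i _ => hs i)
    (fun s hs => Finset.prod_pos fun i _ => hs i)
    (fun a => (contDiff_divBasis a (n := 0)).continuous) (divBasis_injective hd)
  obtain ⟨C₁, hC₁, hup⟩ := exists_upper_bound (d := d) (ι := Option (Fin (d + 1)))
    (p := divBasis) (fun a => contDiff_divBasis a)
  have hWc : ∀ {n : WithTop ℕ∞}, ContDiff ℝ n (fun s : Fin (d + 1) → ℝ => ∏ i, s i) :=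
    contDiff_prod fun i _ => contDiff_apply ℝ ℝ i
  obtain ⟨C₂, hC₂, hgrad⟩ := exists_upper_bound (d := d) (ι := Option (Fin (d + 1)))
    (p := fun a s => (∏ i, s i) * divBasis a s) (fun a => hWc.mul (contDiff_divBasis a))
  -- `|σ|` keeps the constant nonnegative for every real `σ`; once an element exists, regularity
  -- forces `σ ≥ 0`.
  refine ⟨C₁ * C₂ * |σ| / c, by positivity, fun Ω T u vr k hreg hu hvr hres => ?_⟩
  set κ := T.elem k with hκ
  obtain ⟨A, b, hA⟩ := hu.2 k
  obtain ⟨θ, hθ⟩ := exists_div_eq κ A b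
  set D : E d → ℝ := fun x => ∑ a, θ a * divBasis a (bary κ x) with hDdef
  have hbc := continuous_bary κ
  have hDc : Continuous D := by
    have := fun a => (contDiff_divBasis (d := d) a (n := 0)).continuous
    fun_prop
  have hD : ∀ᵐ x ∂vol (cell κ), div u x = D x := by
    filter_upwards [T.ae_div_eq hA] with x hx
    rw [hx, ← hκ, hθ]
  have hDb : ∀ᵐ x ∂vol (cell κ), ‖div u x‖ ≤ C₁ * ‖θ‖ := by
    filter_upwards [hD, ae_restrict_mem (measurableSet_cell κ)] with x hx hxc
    rw [hx]
    exact (hup κ θ x hxc).1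
  have hDm : MemLp (div u) 3 (vol (cell κ)) := by
    refine MemLp.of_bound ?_ _ hDb
    refine hDc.aestronglyMeasurable.congr ?_
    filter_upwards [hD] with x hx using hx.symm
  refine ⟨hDm, ?_⟩
  set N := lpNorm vr 3 (vol (cell κ)) with hN
  have hN0 : 0 ≤ N := lpNorm_nonneg
  set h := Metric.diam (cell κ) with hh
  have hh0 : 0 < h := diam_cell_pos κ
  set V := volume.real (cell κ) with hV
  have hV0 : 0 < V := ENNReal.toReal_pos (volume_cell_pos κ).ne' (volume_cell_lt_top κ).ne
  set a := V ^ (1 / 3 : ℝ) with ha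
  have ha0 : 0 < a := by positivity
  have ha3 : a ^ 3 = V := by
    rw [ha, ← Real.rpow_natCast, ← Real.rpow_mul hV0.le]; norm_num
  have hσ := fun i => norm_coordGrad_mul_diam_le κ (hreg k) i
  have hσ0 : 0 ≤ σ := (by positivity : (0 : ℝ) ≤ _).trans (hσ 0)
  -- Element bubble times the polynomial extending `div u`. It vanishes on all faces, so the
  -- residual is the integral of the bubble times `(div u)²`.
  set Q : E d → ℝ := fun x => ∑ a, θ a * ((∏ i, bary κ x i) * divBasis a (bary κ x)) with hQdef
  have hQ : ContDiff ℝ ∞ Q := by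
    refine ContDiff.sum fun a _ => contDiff_const.mul (ContDiff.mul ?_ ?_)
    · exact hWc.comp (contDiff_bary κ)
    · exact (contDiff_divBasis a).comp (contDiff_bary κ)
  have hQD : ∀ x, Q x = (∏ i, bary κ x i) * D x := by
    intro x
    simp only [hQdef, hDdef, Finset.mul_sum]
    exact Finset.sum_congr rfl fun a _ => by ring
  have hQ0 : ∀ j, ∀ x ∈ face κ j, Q x = 0 := by
    intro j x hx
    rw [hQD, show (∏ i, bary κ x i) = 0 from bubble_eq_zero_of_mem_face κ hx, zero_mul]
  have key := hres Q hQ fun j x hx => Or.inr (hQ0 j x hx)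
  have hR : T.residual u k Q = ∫ x in cell κ, (∏ i, bary κ x i) * D x ^ 2 := by
    rw [residual, Finset.sum_eq_zero, sub_zero]
    · refine integral_congr_ae ?_
      filter_upwards [hD] with x hx
      rw [hx, hQD]
      ring
    · intro j _
      refine integral_eq_zero_of_ae ?_
      filter_upwards [ae_surf_mem κ j] with x hx
      rw [hQ0 j x hx, mul_zero]
      rfl
  have h1 := hlow κ θ
  have h2 := abs_setIntegral_inner_le κ (f := gradient Q) (g := vr) (B := C₂ * ‖θ‖ * (σ / h))
    (fun x hx => (hgrad κ θ x hx).2 _ fun i => (le_div_iff₀ hh0).2 (hσ i)) hvr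
  rw [key, hR] at h2
  have h3 : c * V * ‖θ‖ ^ 2 ≤ C₂ * ‖θ‖ * (σ / h) * (a ^ 2 * N) :=
    h1.trans ((le_abs_self _).trans h2)
  -- Coercivity is quadratic in `‖θ‖` and Hölder linear, so one factor `‖θ‖` and `V^(2/3)` cancel,
  -- leaving `V^(1/3) ‖θ‖`, which dominates the `L³` norm of the divergence up to `C₁`.
  have h4 : c * (h * (a * ‖θ‖)) ≤ C₂ * σ * N := by
    by_cases ht : ‖θ‖ = 0
    · rw [ht]; simp; positivity
    have ht0 : 0 < ‖θ‖ := lt_of_le_of_ne (norm_nonneg _) (Ne.symm ht)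
    rw [← ha3] at h3
    have h5 : (a ^ 2 * ‖θ‖) * (c * (h * (a * ‖θ‖))) ≤ (a ^ 2 * ‖θ‖) * (C₂ * σ * N) := by
      calc (a ^ 2 * ‖θ‖) * (c * (h * (a * ‖θ‖))) = h * (c * a ^ 3 * ‖θ‖ ^ 2) := by ring
        _ ≤ h * (C₂ * ‖θ‖ * (σ / h) * (a ^ 2 * N)) := by gcongr
        _ = (a ^ 2 * ‖θ‖) * (C₂ * σ * N) := by field_simp
    exact le_of_mul_le_mul_left h5 (by positivity)
  have h6 := lpNorm_three_le_of_bound (by positivity) hDb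
  rw [measureReal_restrict_apply_univ] at h6
  rw [abs_of_nonneg hσ0]
  calc h * lpNorm (div u) 3 (vol (cell κ)) ≤ h * (a * (C₁ * ‖θ‖)) := by gcongr
    _ = C₁ / c * (c * (h * (a * ‖θ‖))) := by field_simp
    _ ≤ C₁ / c * (C₂ * σ * N) := by gcongr
    _ = C₁ * C₂ * σ / c * N := by ring

end Triangulation

section Simplex

variable {d : ℕ}

/-- Integrals over a face against the face bubble, as integrals over the simplex. -/
theorem faceInt_bubble_mul [NeZero d]
    (κ : AffineBasis (Fin (d + 1)) ℝ (E d)) {j l : Fin (d + 1)} (h : j ≠ l)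
    (θ : {m // m ≠ j} → ℝ) :
    faceInt κ j (fun x => (∏ i ∈ Finset.univ.erase j, bary κ x i)
        * (∑ m, θ m * bary κ x m) ^ 2)
      = ∫ x in cell κ, (∏ i ∈ (Finset.univ.erase j).erase l, bary κ x i)
        * (∑ m, θ m * (bary κ x m + if (m : Fin (d + 1)) = l then bary κ x j else 0)) ^ 2 := by
  have hbc := continuous_bary κ
  have e1 : ∀ x, (∏ i ∈ Finset.univ.erase j, bary κ x i) * (∑ m, θ m * bary κ x m) ^ 2
      = κ.coord l x * ((∏ i ∈ (Finset.univ.erase j).erase l, bary κ x i)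
        * (∑ m, θ m * bary κ x m) ^ 2) := by
    intro x
    rw [← Finset.mul_prod_erase (Finset.univ.erase j) _
      (Finset.mem_erase.2 ⟨h.symm, Finset.mem_univ l⟩), mul_assoc]
    rfl
  simp only [e1]
  rw [faceInt_coord_mul κ h (g := fun x => (∏ i ∈ (Finset.univ.erase j).erase l, bary κ x i)
        * (∑ m, θ m * bary κ x m) ^ 2) (by fun_prop)]
  congr 1
  funext x
  -- Projecting along the edge onto face `j` hands the weight `λ_j` over to `λ_l` and leaves the
  -- other coordinates unchanged.
  have hb : ∀ m ≠ j, bary κ (x - κ.coord j x • (κ j - κ l)) m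
      = bary κ x m + if m = l then bary κ x j else 0 := by
    intro m hm
    simp only [bary]
    rw [sub_eq_add_neg, ← neg_smul, coord_add_smul_sub, if_neg hm]
    split_ifs <;> ring
  congr 1
  · refine Finset.prod_congr rfl fun i hi => ?_
    rw [hb i (Finset.ne_of_mem_erase (Finset.mem_of_mem_erase hi)),
      if_neg (Finset.ne_of_mem_erase hi), add_zero]
  · congr 1
    exact Finset.sum_congr rfl fun m _ => by rw [hb m m.2]

end Simplex

namespace Triangulation

variable {d : ℕ}

/-- Local efficiency of the boundary part of the indicator. -/
theorem exists_face_estimate (hd : 2 ≤ d) (σ : ℝ) (j : Fin (d + 1)) :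
    ∃ C : ℝ, 0 ≤ C ∧ ∀ (Ω : Set (E d)), IsOpen Ω → HasLipschitzBoundary Ω →
      ∀ (T : Triangulation Ω) (u vr : E d → E d) (k : Fin T.N),
      T.Regular σ → T.MemXh u → MemLp vr 3 (vol (cell (T.elem k))) →
      (∀ Q : E d → ℝ, ContDiff ℝ ∞ Q →
        (∀ j, ∀ x ∈ face (T.elem k) j, x ∈ frontier Ω ∨ Q x = 0) →
        ∫ x in cell (T.elem k), inner ℝ (gradient Q x) (vr x) = T.residual u k Q) →
      Metric.diam (face (T.elem k) j) ^ (1 / 3 : ℝ)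
          * lpNorm (T.phi u k j) 3 (surf (face (T.elem k) j))
        ≤ C * lpNorm vr 3 (vol (cell (T.elem k))) := by
  classical
  have : NeZero d := ⟨by omega⟩
  have : Nontrivial (Fin (d + 1)) := Fin.nontrivial_iff_two_le.2 (by omega)
  obtain ⟨l, hl⟩ := exists_ne j
  have : Nonempty {m // m ≠ j} := ⟨⟨l, hl⟩⟩
  obtain ⟨c, hc, hlow⟩ := exists_lower_bound (d := d) (ι := {m // m ≠ j})
    (W := fun s => ∏ i ∈ (Finset.univ.erase j).erase l, s i)
    (p := fun m s => s m + if (m : Fin (d + 1)) = l then s j else 0) (by fun_prop)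
    (fun s hs => Finset.prod_nonneg fun i _ => hs i)
    (fun s hs => Finset.prod_pos fun i _ => hs i)
    (fun m => by split_ifs <;> fun_prop) (fun θ h => by
      -- Evaluation at vertex `m ≠ j`, where `λ_j = 0`, isolates `θ m`.
      funext m
      have h1 := h _ (single_mem_stdSimplex ℝ (m : Fin (d + 1)))
      rw [Finset.sum_eq_single m] at h1
      · simpa [m.2.symm] using h1
      · intro n _ hn
        have hn' : (n : Fin (d + 1)) ≠ m := fun h => hn (Subtype.ext h)
        simp [hn', m.2.symm]
      · intro hm; exact absurd (Finset.mem_univ m) hm)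
  have hWc : ∀ {n : WithTop ℕ∞},
      ContDiff ℝ n (fun s : Fin (d + 1) → ℝ => ∏ i ∈ Finset.univ.erase j, s i) :=
    contDiff_prod fun i _ => contDiff_apply ℝ ℝ i
  obtain ⟨C₂, hC₂, hup⟩ := exists_upper_bound (d := d) (ι := {m // m ≠ j})
    (p := fun m s => (∏ i ∈ Finset.univ.erase j, s i) * s m)
    (fun m => hWc.mul (contDiff_apply ℝ ℝ _))
  obtain ⟨C₁, hC₁, hdiv⟩ := exists_div_estimate hd σ
  refine ⟨(|σ| * d) ^ (1 / 3 : ℝ) * (C₂ * (C₁ + |σ|) / c), by positivity,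
    fun Ω hΩ hL T u vr k hreg hu hvr hres => ?_⟩
  obtain ⟨hDm, hDle⟩ := hdiv Ω T u vr k hreg hu hvr hres
  set κ := T.elem k with hκ
  set N := lpNorm vr 3 (vol (cell κ)) with hN
  have hN0 : 0 ≤ N := lpNorm_nonneg
  by_cases hf : face κ j ⊆ frontier Ω
  swap
  · have h0 : lpNorm (T.phi u k j) 3 (surf (face κ j)) ≤ 0 := by
      have := isFiniteMeasure_surf_face κ j
      have h1 := lpNorm_three_le_of_bound (μ := surf (face κ j)) (f := T.phi u k j) le_rfl (by
        filter_upwards [ae_surf_mem κ j] with x hx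
        rw [T.phi_eq hΩ hL hu.1 hx, if_neg hf, norm_zero])
      rwa [mul_zero] at h1
    rw [le_antisymm h0 lpNorm_nonneg, mul_zero]
    positivity
  obtain ⟨A, b, hA⟩ := hu.2 k
  set θ : {m // m ≠ j} → ℝ := fun m => inner ℝ (A (κ m)) (normal κ j) with hθ
  have hphi : ∀ x ∈ face κ j, T.phi u k j x = ∑ m, θ m * bary κ x m := by
    intro x hx
    have hu1 : u x = A x := by
      rw [hA (face_subset_cell κ j hx), ← hκ]
      simp only [bubble_eq_zero_of_mem_face κ hx, zero_smul, add_zero]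
    rw [T.phi_eq hΩ hL hu.1 hx, if_pos hf, hu1, affine_eq_sum κ A x, sum_inner,
      Fintype.sum_eq_add_sum_subtype_ne _ j, coord_eq_zero_of_mem_face κ hx, zero_smul,
      inner_zero_left, zero_add]
    refine Finset.sum_congr rfl fun m _ => ?_
    rw [real_inner_smul_left, mul_comm]
    rfl
  set h := Metric.diam (cell κ) with hh
  have hh0 : 0 < h := diam_cell_pos κ
  set V := volume.real (cell κ) with hV
  have hV0 : 0 < V := ENNReal.toReal_pos (volume_cell_pos κ).ne' (volume_cell_lt_top κ).ne
  set a := V ^ (1 / 3 : ℝ) with ha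
  have ha0 : 0 < a := by positivity
  have ha3 : a ^ 3 = V := by
    rw [ha, ← Real.rpow_natCast, ← Real.rpow_mul hV0.le]; norm_num
  have hσ := fun i => norm_coordGrad_mul_diam_le κ (hreg k) i
  have hσ0 : 0 ≤ σ := (by positivity : (0 : ℝ) ≤ _).trans (hσ 0)
  -- Face bubble times the affine extension of `u · n`. It vanishes on every other face; on face `j`
  -- it need not, because that face lies in the boundary of `Ω`.
  set Q : E d → ℝ := fun x => ∑ m, θ m * ((∏ i ∈ Finset.univ.erase j, bary κ x i)
    * bary κ x m) with hQdef
  have hQ : ContDiff ℝ ∞ Q := by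
    refine ContDiff.sum fun m _ => contDiff_const.mul (ContDiff.mul ?_ ?_)
    · exact hWc.comp (contDiff_bary κ)
    · exact contDiff_coord κ m
  have hQl : ∀ x, Q x = (∏ i ∈ Finset.univ.erase j, bary κ x i) * ∑ m, θ m * bary κ x m := by
    intro x
    simp only [hQdef, Finset.mul_sum]
    exact Finset.sum_congr rfl fun a _ => by ring
  have hQ0 : ∀ j' ≠ j, ∀ x ∈ face κ j', Q x = 0 := by
    intro j' hj x hx
    rw [hQl, Finset.prod_eq_zero (Finset.mem_erase.2 ⟨hj, Finset.mem_univ j'⟩)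
      (coord_eq_zero_of_mem_face κ hx), zero_mul]
  have key := hres Q hQ fun j' x hx => by
    by_cases hj : j' = j
    · subst hj; exact Or.inl (hf hx)
    · exact Or.inr (hQ0 j' hj x hx)
  have hR : T.residual u k Q = (∫ x in cell κ, inner ℝ (Q x) (div u x))
      - ‖coordGrad κ j‖ * faceInt κ j (fun x => (∏ i ∈ Finset.univ.erase j, bary κ x i)
        * (∑ m, θ m * bary κ x m) ^ 2) := by
    rw [residual, Finset.sum_eq_single j]
    · congr 1
      · simp [mul_comm]
        rfl
      · rw [← integral_surf_face]
        refine integral_congr_ae ?_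
        filter_upwards [ae_surf_mem κ j] with x hx
        rw [hphi x hx, hQl]
        ring
    · intro j' _ hj
      refine integral_eq_zero_of_ae ?_
      filter_upwards [ae_surf_mem κ j'] with x hx
      rw [hQ0 j' hj x hx, mul_zero]
      rfl
    · intro hj; exact absurd (Finset.mem_univ j) hj
  rw [faceInt_bubble_mul κ hl.symm] at hR
  have h1 := hlow κ θ
  have h2 := abs_setIntegral_inner_le κ (f := gradient Q) (g := vr) (B := C₂ * ‖θ‖ * (σ / h))
    (fun x hx => (hup κ θ x hx).2 _ fun i => (le_div_iff₀ hh0).2 (hσ i)) hvr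
  have h3 := abs_setIntegral_inner_le κ (f := Q) (g := div u) (B := C₂ * ‖θ‖)
    (fun x hx => (hup κ θ x hx).1) hDm
  set δ := lpNorm (div u) 3 (vol (cell κ)) with hδ
  set g := ‖coordGrad κ j‖ with hg
  have hg0 : 0 < g := norm_pos_iff.2 (coordGrad_ne_zero κ hl.symm)
  rw [key, hR] at h2
  set I := ∫ x in cell κ, (∏ i ∈ (Finset.univ.erase j).erase l, bary κ x i)
        * (∑ m, θ m * (bary κ x m + if (m : Fin (d + 1)) = l then bary κ x j else 0)) ^ 2
  have h4 : g * (c * V * ‖θ‖ ^ 2) ≤ C₂ * ‖θ‖ * (a ^ 2 * δ) + C₂ * ‖θ‖ * (σ / h) * (a ^ 2 * N) := by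
    have e1 : g * (c * V * ‖θ‖ ^ 2) ≤ g * I := by gcongr
    have e2 := (abs_le.1 h2).1
    have e3 := (abs_le.1 h3).2
    linarith
  have h5 : c * (a * ‖θ‖) ≤ C₂ * (C₁ + σ) * N := by
    by_cases ht : ‖θ‖ = 0
    · rw [ht]; simp; positivity
    have ht0 : 0 < ‖θ‖ := lt_of_le_of_ne (norm_nonneg _) (Ne.symm ht)
    rw [← ha3] at h4
    have h5 : (a ^ 2 * ‖θ‖) * (c * (a * ‖θ‖)) ≤ (a ^ 2 * ‖θ‖) * (C₂ * (C₁ + σ) * N) := by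
      -- Inserting `g h ≥ 1` supplies the factor `g` of the surface measure needed for `h4`, while
      -- `h` turns `δ` into the quantity `h δ` bounded by the divergence estimate.
      calc (a ^ 2 * ‖θ‖) * (c * (a * ‖θ‖)) ≤ (g * h) * ((a ^ 2 * ‖θ‖) * (c * (a * ‖θ‖))) :=
            le_mul_of_one_le_left (by positivity) (one_le_norm_coordGrad_mul_diam κ j)
        _ = h * (g * (c * a ^ 3 * ‖θ‖ ^ 2)) := by ring
        _ ≤ h * (C₂ * ‖θ‖ * (a ^ 2 * δ) + C₂ * ‖θ‖ * (σ / h) * (a ^ 2 * N)) := by gcongr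
        _ = (a ^ 2 * ‖θ‖) * (C₂ * (h * δ + σ * N)) := by field_simp
        _ ≤ (a ^ 2 * ‖θ‖) * (C₂ * (C₁ * N + σ * N)) := by gcongr
        _ = (a ^ 2 * ‖θ‖) * (C₂ * (C₁ + σ) * N) := by ring
    exact le_of_mul_le_mul_left h5 (by positivity)
  have hfin := isFiniteMeasure_surf_face κ j
  have hphib : ∀ᵐ x ∂surf (face κ j), ‖T.phi u k j x‖ ≤ ‖θ‖ := by
    filter_upwards [ae_surf_mem κ j] with x hx
    have hxc := face_subset_cell κ j hx
    rw [hphi x hx]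
    calc ‖∑ m, θ m * bary κ x m‖ ≤ ∑ m : {m // m ≠ j}, ‖θ‖ * bary κ x m := by
          refine norm_sum_le_of_le _ fun m _ => ?_
          have hm : 0 ≤ bary κ x m := (mem_cell κ).1 hxc m
          rw [norm_mul, Real.norm_of_nonneg hm]
          gcongr
          exact norm_le_pi_norm θ m
      _ = ‖θ‖ := by
          have hs := κ.sum_coord_apply_eq_one x
          rw [Fintype.sum_eq_add_sum_subtype_ne _ j, coord_eq_zero_of_mem_face κ hx, zero_add] at hs
          rw [← Finset.mul_sum]
          simp only [bary]
          rw [hs, mul_one]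
  have h6 := lpNorm_three_le_of_bound (norm_nonneg θ) hphib
  -- The area of the face is `g d V`. Multiplied by `h` it is at most `σ d V`, whence the factor `(σ
  -- d)^(1/3)` in the constant.
  have hsurf : (surf (face κ j)).real univ = g * (d * V) := by
    have := integral_surf_face κ j (fun _ => 1)
    rw [faceInt_one] at this
    simpa using this
  rw [hsurf] at h6
  have hdf : Metric.diam (face κ j) ≤ h :=
    Metric.diam_mono (face_subset_cell κ j) (isCompact_cell κ).isBounded
  rw [abs_of_nonneg hσ0]
  calc Metric.diam (face κ j) ^ (1 / 3 : ℝ) * lpNorm (T.phi u k j) 3 (surf (face κ j))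
      ≤ h ^ (1 / 3 : ℝ) * ((g * (d * V)) ^ (1 / 3 : ℝ) * ‖θ‖) := by
        gcongr
        exact lpNorm_nonneg
    _ = (g * h * d) ^ (1 / 3 : ℝ) * (a * ‖θ‖) := by
        rw [Real.mul_rpow hg0.le (by positivity), Real.mul_rpow (by positivity) hV0.le,
          Real.mul_rpow (by positivity) (by positivity), Real.mul_rpow hg0.le hh0.le]
        ring
    _ ≤ (σ * d) ^ (1 / 3 : ℝ) * (a * ‖θ‖) := by
        have := hσ j
        gcongr
    _ = (σ * d) ^ (1 / 3 : ℝ) * (c * (a * ‖θ‖) / c) := by field_simp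
    _ ≤ (σ * d) ^ (1 / 3 : ℝ) * (C₂ * (C₁ + σ) * N / c) := by gcongr
    _ = (σ * d) ^ (1 / 3 : ℝ) * (C₂ * (C₁ + σ) / c) * N := by ring

theorem IsIteration.memXh {Ω : Set (E d)} {T : Triangulation Ω} {D : Coeffs d} {γ : ℝ}
    {u : ℕ → E d → E d} {p C : ℕ → E d → ℝ} (h : T.IsIteration D γ u p C) (i : ℕ) :
    T.MemXh (u i) := by
  cases i with
  | zero => exact h.1
  | succ i => exact (h.2.2 i).1

theorem MemXh.memLp {Ω : Set (E d)} {T : Triangulation Ω} {u : E d → E d} (hu : T.MemXh u)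
    (k : Fin T.N) (p : ℝ≥0∞) : MemLp u p (vol (cell (T.elem k))) := by
  have hc : ContinuousOn u (cell (T.elem k)) := hu.1.mono (T.cell_subset_closure k)
  obtain ⟨C, hC⟩ := (isCompact_cell (T.elem k)).exists_bound_of_continuousOn hc
  exact MemLp.of_bound
    (hc.aestronglyMeasurable_of_isCompact (isCompact_cell _) (measurableSet_cell _)) C
    ((ae_restrict_mem (measurableSet_cell _)).mono hC)

end Triangulation
end

end DarcyForchheimer

/-! ### Assembly of the two bounds. -/

theorem mainTheorem5 (d : ℕ) (hd : d = 2 ∨ d = 3) (σ : ℝ) :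
    ∃ c : ℝ, 0 < c ∧
      ∀ (Ω : Set (DarcyForchheimer.E d)), IsOpen Ω → Bornology.IsBounded Ω →
        IsSimplyConnected Ω → DarcyForchheimer.HasLipschitzBoundary Ω →
      ∀ (D : DarcyForchheimer.Coeffs d), D.Admissible Ω →
      ∀ (u : DarcyForchheimer.E d → DarcyForchheimer.E d) (p C : DarcyForchheimer.E d → ℝ),
        D.IsWeakSolution Ω u p C →
      ∀ (T : DarcyForchheimer.Triangulation Ω), T.Regular σ →
      ∀ (γ : ℝ), 0 < γ →
      ∀ (uh : ℕ → DarcyForchheimer.E d → DarcyForchheimer.E d)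
        (ph Ch : ℕ → DarcyForchheimer.E d → ℝ), T.IsIteration D γ uh ph Ch →
      ∀ (i : ℕ) (k : Fin T.N),
        T.etaL1 (uh i) (uh (i + 1)) k
            ≤ lpNorm (u - uh i) 2 (DarcyForchheimer.vol (DarcyForchheimer.cell (T.elem k)))
              + lpNorm (u - uh (i + 1)) 2
                  (DarcyForchheimer.vol (DarcyForchheimer.cell (T.elem k))) ∧
        ∀ (rh : (DarcyForchheimer.E d → ℝ) → (DarcyForchheimer.E d → ℝ)),
          (∀ q G, DarcyForchheimer.MemM Ω q G → T.MemP1 (rh q)) →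
        ∀ (vr : DarcyForchheimer.E d → DarcyForchheimer.E d), T.IsLifting rh (uh (i + 1)) vr →
          T.etaD3 (uh (i + 1)) k
            ≤ c * lpNorm vr 3 (DarcyForchheimer.vol (T.patch k)) := by
  have hd2 : 2 ≤ d := by omega
  have : NeZero d := ⟨by omega⟩
  obtain ⟨C₁, hC₁, hdiv⟩ := DarcyForchheimer.Triangulation.exists_div_estimate hd2 σ
  choose C₂ hC₂ hface using fun j => DarcyForchheimer.Triangulation.exists_face_estimate hd2 σ j
  have hC₂' : 0 ≤ ∑ j, C₂ j := Finset.sum_nonneg fun j _ => hC₂ j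
  -- All constants are fixed before the domain and the mesh; the summand 1 makes the total strictly
  -- positive.
  refine ⟨C₁ + ∑ j, C₂ j + 1, by positivity, ?_⟩
  intro Ω hΩ hb _ hL D _ u p C hsol T hreg γ _ uh ph Ch hit i k
  have hX := hit.memXh
  refine ⟨?_, fun rh hrh vr hvr => ?_⟩
  · obtain ⟨-, -, hu, -⟩ := hsol
    have hu2 : MemLp u 2 (DarcyForchheimer.vol (DarcyForchheimer.cell (T.elem k))) :=
      (hu.mono_measure (T.vol_cell_le hΩ hL k)).mono_exponent (by norm_num)
    have h1 := lpNorm_sub_le (g := u - uh (i + 1)) (hu2.sub ((hX i).memLp k 2)) (by norm_num)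
    rwa [sub_sub_sub_cancel_left] at h1
  · have hle : DarcyForchheimer.vol (DarcyForchheimer.cell (T.elem k))
        ≤ DarcyForchheimer.vol (T.patch k) :=
      Measure.restrict_mono (T.cell_subset_patch k) le_rfl
    have hvp : MemLp vr 3 (DarcyForchheimer.vol (T.patch k)) :=
      hvr.1.mono_measure (T.vol_patch_le hΩ hL k)
    have hvc : MemLp vr 3 (DarcyForchheimer.vol (DarcyForchheimer.cell (T.elem k))) :=
      hvp.mono_measure hle
    -- The estimates hold with the norm over the element alone; the patch enters only by
    -- monotonicity.
    have hN : lpNorm vr 3 (DarcyForchheimer.vol (DarcyForchheimer.cell (T.elem k)))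
        ≤ lpNorm vr 3 (DarcyForchheimer.vol (T.patch k)) := by
      rw [← toReal_eLpNorm hvc.1, ← toReal_eLpNorm hvp.1]
      exact ENNReal.toReal_mono hvp.2.ne (eLpNorm_mono_measure _ hle)
    have hres := fun Q hQ h0 => hvr.setIntegral_inner_gradient hΩ hb hL (hX (i + 1))
      (hit.2.2 i).2.2.2.2.1 hrh k (Q := Q) hQ h0
    have e1 := (hdiv Ω T _ vr k hreg (hX (i + 1)) hvc hres).2
    have e2 := fun j => hface j Ω hΩ hL T _ vr k hreg (hX (i + 1)) hvc hres
    set N := lpNorm vr 3 (DarcyForchheimer.vol (DarcyForchheimer.cell (T.elem k)))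
    have hN0 : 0 ≤ N := lpNorm_nonneg
    calc T.etaD3 (uh (i + 1)) k ≤ C₁ * N + ∑ j, C₂ j * N :=
          add_le_add e1 (Finset.sum_le_sum fun j _ => e2 j)
      _ = (C₁ + ∑ j, C₂ j) * N := by rw [← Finset.sum_mul, add_mul]
      _ ≤ (C₁ + ∑ j, C₂ j + 1) * N := mul_le_mul_of_nonneg_right (by linarith) hN0
      _ ≤ _ := by gcongr
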